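/- Let $\alpha>1$, let $\Pi^+=\{z=x+iy\in\mathbb{C}: y>0\}$, and let $\psi_\alpha(t)=\int_0^\infty \xi^{\frac{\alpha-1}{2}}e^{-\xi}e^{i\xi t}\,d\xi$ be the Cauchy wavelet, i.e. the function whose Fourier transform is $\widehat{\psi_\alpha}(\xi)=\xi^{\frac{\alpha-1}{2}}e^{-\xi}$ for $\xi\ge 0$ and $0$ for $\xi<0$. Write $\mathbf T_x\mathbf D_y\psi_\alpha(t)=y^{-1/2}\psi_\alpha\big(\tfrac{t-x}{y}\big)$. Let $(a_n)_{n\ge0}$ be independent standard complex Gaussian random variables on a probability space $(\Omega,\mathcal F,\mathbb P)$, let $(e_n)_{n\ge0}$ be an orthonormal basis of $L^2(\mathbb{R})$, and let $\mathcal N$ be the complex white noise $\mathcal N(s)=\sum_{n=0}^\infty a_n\langle s,e_n\rangle$, $s\in L^2(\mathbb{R})$ (convergence in $L^2(\Omega)$). The wavelet transform of white noise is $$W_{\psi_\alpha}(\mathcal N)(x+iy)=\mathcal N(\mathbf T_x\mathbf D_y\psi_\alpha)=\sum_{n=0}^\infty a_n\langle \mathbf T_x\mathbf D_y\psi_\alpha,e_n\rangle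 ,$$ where the series converges almost surely, locally uniformly on $\Pi^+$. For $L\in\mathbb{N}$ and $T_s>0$ let $\mathcal N_{L,T_s}[\ell]=\mathcal N(\mathbb 1_{((\ell-1)T_s,\ell T_s)})$ for $\ell\in\{-L+1,\dots,L\}$ ($2L$ noise samples), and let the discretized continuous wavelet transform of these samples be $$W^{(d)}_{\psi_\alpha}(\mathcal N_{L,T_s})(x+iy)=\sum_{\ell=-L+1}^{L}\mathcal N_{L,T_s}[\ell]\;\mathbf T_x\mathbf D_y\psi_\alpha(\ell T_s).$$ Theorem. For $T_s=L^{-\frac{\alpha}{\alpha+2}}$, almost surely, for every compact $D\subset\Pi^+$, $$\lim_{L\to\infty}\ \sup_{z\in D}\Big|W^{(d)}_{\psi_\alpha}(\mathcal N_{L,T_s})(z)-W_{\psi_\alpha}(\mathcal N)(z)\Big|=0 .$$ Moreover, there is a constant $c_\alpha>0$ such that $W_{\psi_\alpha}(\mathcal N)(x+iy)=\frac{y^{\alpha/2}}{c_\alpha}\,\overline{f_\alpha(x+iy)}$ on $\Pi^+$, where $f_\alpha$ is a hyperbolic Gaussian analytic function, that is, a random function on $\Pi^+$ with almost surely analytic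 realizations whose finite-dimensional distributions are centred circularly symmetric complex Gaussian with covariance $$\mathbb E\big[f_\alpha(z)\overline{f_\alpha(w)}\big]=\frac{2^{\alpha-2}(\alpha-1)}{(-i)^\alpha(z-\bar w)^\alpha}.$$ -/

import Mathlib

open MeasureTheory ProbabilityTheory Filter Topology

noncomputable section

namespace WaveletNoise

/-- The open upper half-plane `Π⁺`. -/
def halfPlane : Set ℂ := {z | 0 < z.im}

/-! ### Wavelets -/

/-- The prescribed Fourier transform `ξ ^ ((α - 1) / 2) * exp (-ξ)` on `ξ ≥ 0`, and `0` on
`ξ < 0`. -/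
def cauchyWaveletHat (α : ℝ) (ξ : ℝ) : ℝ :=
  if 0 ≤ ξ then ξ ^ ((α - 1) / 2) * Real.exp (-ξ) else 0

/-- The Cauchy wavelet `ψ_α`, as the inverse Fourier integral of `cauchyWaveletHat α`, with the
normalization `ψ t = ∫ ψ̂ ξ * exp (i ξ t) dξ`. -/
def cauchyWavelet (α : ℝ) (t : ℝ) : ℂ :=
  ∫ ξ : ℝ, (cauchyWaveletHat α ξ : ℂ) * Complex.exp (Complex.I * ξ * t)

/-- Translation `(T_x s) t = s (t - x)`. -/
def translate (x : ℝ) (s : ℝ → ℂ) (t : ℝ) : ℂ := s (t - x)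

/-- Dilation `(D_y s) t = y ^ (-1/2) * s (t / y)`. -/
def dilate (y : ℝ) (s : ℝ → ℂ) (t : ℝ) : ℂ := ((y ^ (-(1 / 2) : ℝ) : ℝ) : ℂ) * s (t / y)

/-- `T_x D_y ψ_α`, where `z = x + i y`. -/
def waveletAtom (α : ℝ) (z : ℂ) : ℝ → ℂ := translate z.re (dilate z.im (cauchyWavelet α))

/-! ### Complex Gaussians and white noise -/

/-- The centred circularly symmetric complex Gaussian law of variance `v = E |Z| ^ 2`: real and
imaginary part are independent centred real Gaussians of variance `v / 2`. -/
def complexGaussian (v : NNReal) : Measure ℂ :=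
  ((gaussianReal 0 (v / 2)).prod (gaussianReal 0 (v / 2))).map
    (fun p : ℝ × ℝ => (p.1 : ℂ) + (p.2 : ℂ) * Complex.I)

/-- `a 0, a 1, …` are independent standard complex Gaussians. -/
structure IsStdComplexGaussianSeq {Ω : Type*} [MeasurableSpace Ω] (P : Measure Ω)
    (a : ℕ → Ω → ℂ) : Prop where
  hasLaw : ∀ n, HasLaw (a n) (complexGaussian 1) P
  indep : iIndepFun a P

/-- An orthonormal basis of `L²(ℝ)` indexed by `ℕ`. -/
abbrev L2Basis : Type := HilbertBasis ℕ ℂ (Lp ℂ 2 (volume : Measure ℝ))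

/-- The inner product `⟨s, e_n⟩ = ∫ s(t) conj (e_n(t)) dt` in `L²(ℝ)`. -/
def coeff (e : L2Basis) (s : ℝ → ℂ) (n : ℕ) : ℂ :=
  ∫ t : ℝ, s t * (starRingEnd ℂ) ((e n : ℝ → ℂ) t)

/-- Partial sums of `∑ aₙ ⟨s, eₙ⟩`. -/
def noisePartialSum {Ω : Type*} (a : ℕ → Ω → ℂ) (e : L2Basis) (s : ℝ → ℂ) (m : ℕ) (ω : Ω) : ℂ :=
  ∑ n ∈ Finset.range m, a n ω * coeff e s n

/-- `N` is the white noise with coefficients `a` in the basis `e`: for every square integrable `s`,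
the random variable `N s` is the limit in `L²(Ω)` of the series `∑ aₙ ⟨s, eₙ⟩`. (This determines
each `N s` up to a null event; any choice of representatives is allowed.) -/
def IsWhiteNoise {Ω : Type*} [MeasurableSpace Ω] (P : Measure Ω) (a : ℕ → Ω → ℂ) (e : L2Basis)
    (N : (ℝ → ℂ) → Ω → ℂ) : Prop :=
  ∀ s : ℝ → ℂ, MemLp s 2 (volume : Measure ℝ) →
    MemLp (N s) 2 P ∧
      Tendsto (fun m => eLpNorm (fun ω => noisePartialSum a e s m ω - N s ω) 2 P) atTop (𝓝 0)

/-- The continuous wavelet transform of white noise: the realization-wise sum of the random series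
`∑ aₙ ⟨T_x D_y ψ_α, eₙ⟩` at `z = x + i y`. -/
def noiseWT {Ω : Type*} (α : ℝ) (a : ℕ → Ω → ℂ) (e : L2Basis) (z : ℂ) (ω : Ω) : ℂ :=
  limUnder atTop (fun m : ℕ => noisePartialSum a e (waveletAtom α z) m ω)

/-- The noise samples `N_{L,T}[ℓ]`, obtained by applying `N` to the indicator function of
`((ℓ - 1) T, ℓ T)`. -/
def noiseSample {Ω : Type*} (N : (ℝ → ℂ) → Ω → ℂ) (T : ℝ) (ℓ : ℤ) : Ω → ℂ :=
  N ((Set.Ioo (((ℓ : ℝ) - 1) * T) ((ℓ : ℝ) * T)).indicator (fun _ => (1 : ℂ)))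

/-- The discretized continuous wavelet transform of the `2 L` samples `ℓ = -L+1, …, L`. -/
def discreteNoiseWT {Ω : Type*} (α : ℝ) (N : (ℝ → ℂ) → Ω → ℂ) (L : ℕ) (T : ℝ) (z : ℂ) (ω : Ω) : ℂ :=
  ∑ ℓ ∈ Finset.Icc (-(L : ℤ) + 1) (L : ℤ), noiseSample N T ℓ ω * waveletAtom α z ((ℓ : ℝ) * T)

/-- The sampling interval `L ^ (-α / (α + 2))`. -/
def samplingInterval (α : ℝ) (L : ℕ) : ℝ := (L : ℝ) ^ (-(α / (α + 2)))

/-! ### The hyperbolic Gaussian analytic function -/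

/-- The reproducing kernel
`K(z, w) = 2 ^ (α - 2) (α - 1) / ((-i) ^ α (z - conj w) ^ α)` of the weighted Bergman space on
the upper half-plane (principal branches). -/
def bergmanKernel (α : ℝ) (z w : ℂ) : ℂ :=
  ((2 ^ (α - 2) * (α - 1) : ℝ) : ℂ) /
    ((-Complex.I) ^ (α : ℂ) * (z - (starRingEnd ℂ) w) ^ (α : ℂ))

/-- `f` is a hyperbolic Gaussian analytic function: its realizations are almost surely analytic on
the upper half-plane, and its finite-dimensional distributions are centred circularly symmetric
complex Gaussian with covariance `E [f z * conj (f w)] = K(z, w)` (expressed through arbitrary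
complex linear combinations). -/
structure IsHyperbolicGAF {Ω : Type*} [MeasurableSpace Ω] (P : Measure Ω) (α : ℝ)
    (f : ℂ → Ω → ℂ) : Prop where
  analytic : ∀ᵐ ω ∂P, DifferentiableOn ℂ (fun z => f z ω) halfPlane
  gaussian : ∀ (k : ℕ) (z : Fin k → ℂ) (c : Fin k → ℂ), (∀ j, z j ∈ halfPlane) →
    ∃ v : NNReal,
      ((v : ℝ) : ℂ) = ∑ i, ∑ j, c i * (starRingEnd ℂ) (c j) * bergmanKernel α (z i) (z j) ∧
      HasLaw (fun ω => ∑ j, c j * f (z j) ω) (complexGaussian v) P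

end WaveletNoise

end

/-!
The proof moves everything into Hilbert spaces of functions on circles.

Up to the factor `y ^ (α / 2)`, the analyzing wavelet at `z` is the conjugate of the kernel
`powerKernel ((α + 1) / 2) z t = Γ((α + 1) / 2) (-i (z - t)) ^ (-(α + 1) / 2)` (`waveletAtom_eq`), so
its coefficients in the basis are conjugates of holomorphic functions of `z`. Restricted to a circle
in the half-plane, they are vectors `v n` of the Hilbert space `L²` of the circle; by Bessel's
inequality `∑ ‖v n‖ ^ 2` is at most the integral over the circle of the squared `L²(ℝ)`-norm of the
wavelet, and by Cauchy's integral formula the norm of `∑ xₙ vₙ` dominates the supremum of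
`∑ xₙ coeffₙ` over the concentric disc of half the radius (`exists_circle_vectors`). Locally uniform
statements about the random functions thereby reduce to Gaussian series with coefficients in a
Hilbert space, of which two facts are needed.

* If `∑ ‖v n‖ ^ 2 < ∞`, then `∑ aₙ vₙ` has almost surely Cauchy partial sums: the squared norms of
  its blocks form a submartingale, to which the maximal inequality applies
  (`ae_cauchySeq_sum_smul`). This yields the locally uniform convergence of the random series.
* The fourth moment of `‖∑ aₙ vₙ‖` is at most a constant times `(∑ ‖v n‖ ^ 2) ^ 2`. With Fatou's
  lemma and a Borel–Cantelli argument, series with square summable variances tend to zero almost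
  surely (`ae_tendsto_liminf_norm_pow_four`).

The second fact is applied to the sampling error, the difference of the step function through the
samples of the wavelet and the wavelet itself. By the mean value theorem inside the window of length
`L T` and by the decay `|t| ^ (-(α + 1) / 2)` outside, its mean square is, up to a constant and
locally uniformly in `z`, at most `L ^ (-3 α / (2 (α + 2)))` (`exists_integral_samplingError_le`).
Evaluating the tail integral would give the exponent `2 α / (α + 2)`; the weaker bound avoids this,
and its square is still summable, since `3 α / (α + 2) > 1` for `α > 1`. Fourth moments are used
because the variances themselves need not be summable when `α ≤ 2`.

Finally, removing the factor `y ^ (α / 2)` and conjugating turns the transform into a locally uniform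
limit of holomorphic functions. Its linear combinations are sums of Gaussian series, whose laws are
computed through characteristic functions (`hasLaw_of_tendsto_sum`), and the covariance
`∫ K_z conj(K_w)` of the kernels is evaluated by Plancherel's identity, which turns it into the
Gamma integral `2 π ∫ ξ ^ (α - 1) exp (i ξ (z - conj w)) dξ` (`integral_powerKernel_mul_conj`).
-/

noncomputable section

namespace WaveletNoise

open Complex ComplexConjugate

/-! ### The complex Gaussian law -/

instance isProbabilityMeasure_complexGaussian (v : NNReal) :
    IsProbabilityMeasure (complexGaussian v) :=
  Measure.isProbabilityMeasure_map (by fun_prop)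

theorem integral_complexGaussian (v : NNReal) {E : Type*} [NormedAddCommGroup E] [NormedSpace ℝ E]
    {g : ℂ → E} (hg : StronglyMeasurable g) :
    ∫ z, g z ∂complexGaussian v =
      ∫ p : ℝ × ℝ, g ((p.1 : ℂ) + (p.2 : ℂ) * I)
        ∂((gaussianReal 0 (v / 2)).prod (gaussianReal 0 (v / 2))) := by
  rw [complexGaussian, integral_map (by fun_prop) hg.aestronglyMeasurable]

theorem charFun_complexGaussian (v : NNReal) (t : ℂ) :
    charFun (complexGaussian v) t = cexp (-(((v : ℝ) / 4 * ‖t‖ ^ 2 : ℝ) : ℂ)) := by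
  rw [charFun_apply, integral_complexGaussian]
  swap
  · exact Continuous.stronglyMeasurable (by fun_prop)
  have h : ∀ p : ℝ × ℝ, cexp (((inner ℝ ((p.1 : ℂ) + (p.2 : ℂ) * I) t : ℝ) : ℂ) * I) =
      cexp (t.re * p.1 * I) * cexp (t.im * p.2 * I) := by
    intro p
    rw [← Complex.exp_add]
    congr 1
    simp [Complex.inner]
    ring
  simp_rw [h]
  rw [integral_prod_mul (fun x : ℝ => cexp (t.re * x * I)) (fun x : ℝ => cexp (t.im * x * I)),
    ← charFun_apply_real, ← charFun_apply_real, charFun_gaussianReal, charFun_gaussianReal,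
    ← Complex.exp_add]
  congr 1
  rw [← Complex.normSq_eq_norm_sq, Complex.normSq_apply]
  push_cast
  ring

theorem hasLaw_complexGaussian_of_charFun {Ω : Type*} [MeasurableSpace Ω] {P : Measure Ω}
    [IsProbabilityMeasure P] {Z : Ω → ℂ} (hZ : AEMeasurable Z P) {v : NNReal}
    (h : ∀ t : ℂ, charFun (P.map Z) t = cexp (-(((v : ℝ) / 4 * ‖t‖ ^ 2 : ℝ) : ℂ))) :
    HasLaw Z (complexGaussian v) P where
  aemeasurable := hZ
  map_eq := by
    have := Measure.isProbabilityMeasure_map hZ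
    exact Measure.ext_of_charFun (funext fun t => by rw [h, charFun_complexGaussian])

/-- The complex Gaussian law is invariant under conjugation. -/
theorem hasLaw_conj_complexGaussian {Ω : Type*} [MeasurableSpace Ω] {P : Measure Ω}
    [IsProbabilityMeasure P] {Z : Ω → ℂ} {v : NNReal} (h : HasLaw Z (complexGaussian v) P) :
    HasLaw (fun ω => (starRingEnd ℂ) (Z ω)) (complexGaussian v) P := by
  have hm : AEMeasurable (fun ω => (starRingEnd ℂ) (Z ω)) P :=
    Complex.continuous_conj.measurable.comp_aemeasurable h.aemeasurable
  refine hasLaw_complexGaussian_of_charFun hm fun t => ?_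
  have h1 := charFun_complexGaussian v ((starRingEnd ℂ) t)
  rw [← h.map_eq, charFun_apply, integral_map h.aemeasurable
    (Continuous.aestronglyMeasurable (by fun_prop))] at h1
  rw [charFun_apply, integral_map hm (Continuous.aestronglyMeasurable (by fun_prop))]
  rw [Complex.norm_conj] at h1
  rw [← h1]
  congr 1
  funext ω
  simp [Complex.inner]

theorem memLp_id_complexGaussian (v : NNReal) :
    MemLp (fun z : ℂ => z) 4 (complexGaussian v) := by
  rw [complexGaussian, memLp_map_measure_iff (Continuous.aestronglyMeasurable (by fun_prop))
    (by fun_prop)]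
  have h := memLp_id_gaussianReal' (μ := 0) (v := v / 2) 4 (by simp)
  have h1 : MemLp (fun p : ℝ × ℝ => (p.1 : ℂ)) 4
      ((gaussianReal 0 (v / 2)).prod (gaussianReal 0 (v / 2))) := (h.comp_fst _).ofReal
  have h2 : MemLp (fun p : ℝ × ℝ => (p.2 : ℂ) * I) 4
      ((gaussianReal 0 (v / 2)).prod (gaussianReal 0 (v / 2))) :=
    MemLp.mul_const (h.comp_snd _).ofReal I
  exact h1.add h2

theorem integral_id_complexGaussian (v : NNReal) : ∫ z, z ∂complexGaussian v = 0 := by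
  rw [integral_complexGaussian v (g := fun z : ℂ => z) stronglyMeasurable_id]
  have h := (memLp_id_gaussianReal' (μ := 0) (v := v / 2) 1 (by simp))
  have h1 : Integrable (fun p : ℝ × ℝ => (p.1 : ℂ))
      ((gaussianReal 0 (v / 2)).prod (gaussianReal 0 (v / 2))) :=
    (memLp_one_iff_integrable.1 (h.comp_fst _)).ofReal
  have h2 : Integrable (fun p : ℝ × ℝ => (p.2 : ℂ) * I)
      ((gaussianReal 0 (v / 2)).prod (gaussianReal 0 (v / 2))) :=
    Integrable.mul_const (memLp_one_iff_integrable.1 (h.comp_snd _)).ofReal I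
  rw [integral_add h1 h2, integral_mul_const,
    integral_fun_fst (f := fun x : ℝ => (x : ℂ)), integral_fun_snd (f := fun x : ℝ => (x : ℂ)),
    integral_complex_ofReal]
  have := integral_id_gaussianReal (μ := 0) (v := v / 2)
  simp [this]

theorem integral_norm_sq_complexGaussian (v : NNReal) : ∫ z, ‖z‖ ^ 2 ∂complexGaussian v = v := by
  rw [integral_complexGaussian v (g := fun z : ℂ => ‖z‖ ^ 2)
    (Continuous.stronglyMeasurable (by fun_prop))]
  have h := (memLp_id_gaussianReal' (μ := 0) (v := v / 2) 2 (by simp))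
  have h1 := (h.comp_fst (gaussianReal 0 (v / 2))).integrable_sq
  have h2 := (h.comp_snd (gaussianReal 0 (v / 2))).integrable_sq
  have h3 : ∫ x, x ^ 2 ∂gaussianReal 0 (v / 2) = v / 2 := by
    have := variance_id_gaussianReal (μ := 0) (v := v / 2)
    rw [variance_eq_sub h] at this
    simpa using this
  have h4 : ∀ p : ℝ × ℝ, ‖(p.1 : ℂ) + (p.2 : ℂ) * I‖ ^ 2 = p.1 ^ 2 + p.2 ^ 2 := by
    intro p
    rw [← Complex.normSq_eq_norm_sq, Complex.normSq_add_mul_I]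
  simp_rw [h4]
  simp only [id] at h1 h2
  rw [integral_add h1 h2, integral_fun_fst (f := fun x : ℝ => x ^ 2),
    integral_fun_snd (f := fun x : ℝ => x ^ 2), h3]
  simp

/-- The fourth absolute moment of the standard complex Gaussian law. -/
def fourthMoment : ℝ := ∫ z, ‖z‖ ^ 4 ∂complexGaussian 1

section Sequence

variable {Ω : Type*} [MeasurableSpace Ω] {P : Measure Ω} {a : ℕ → Ω → ℂ}

theorem IsStdComplexGaussianSeq.memLp (ha : IsStdComplexGaussianSeq P a) (n : ℕ) :
    MemLp (a n) 4 P := by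
  have h := memLp_id_complexGaussian 1
  rw [← (ha.hasLaw n).map_eq, memLp_map_measure_iff
    (Continuous.aestronglyMeasurable (by fun_prop)) (ha.hasLaw n).aemeasurable] at h
  exact h

theorem IsStdComplexGaussianSeq.integral_eq_zero (ha : IsStdComplexGaussianSeq P a) (n : ℕ) :
    ∫ ω, a n ω ∂P = 0 := by
  rw [(ha.hasLaw n).integral_eq, integral_id_complexGaussian]

theorem IsStdComplexGaussianSeq.integral_norm_sq (ha : IsStdComplexGaussianSeq P a) (n : ℕ) :
    ∫ ω, ‖a n ω‖ ^ 2 ∂P = 1 := by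
  have := (ha.hasLaw n).integral_comp (f := fun z : ℂ => ‖z‖ ^ 2)
    (Continuous.aestronglyMeasurable (by fun_prop))
  rw [integral_norm_sq_complexGaussian] at this
  simpa using this

theorem IsStdComplexGaussianSeq.integral_norm_pow_four (ha : IsStdComplexGaussianSeq P a) (n : ℕ) :
    ∫ ω, ‖a n ω‖ ^ 4 ∂P = fourthMoment :=
  (ha.hasLaw n).integral_comp (f := fun z : ℂ => ‖z‖ ^ 4)
    (Continuous.aestronglyMeasurable (by fun_prop))

/-- Replacing each variable by a measurable version. -/
theorem IsStdComplexGaussianSeq.exists_measurable (ha : IsStdComplexGaussianSeq P a) :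
    ∃ b : ℕ → Ω → ℂ, IsStdComplexGaussianSeq P b ∧ (∀ n, Measurable (b n)) ∧
      ∀ᵐ ω ∂P, ∀ n, a n ω = b n ω := by
  refine ⟨fun n => (ha.hasLaw n).aemeasurable.mk (a n), ⟨fun n => ?_, ?_⟩, fun n => ?_, ?_⟩
  · exact (ha.hasLaw n).congr (ha.hasLaw n).aemeasurable.ae_eq_mk.symm
  · exact (iIndepFun_congr fun n => (ha.hasLaw n).aemeasurable.ae_eq_mk).1 ha.indep
  · exact (ha.hasLaw n).aemeasurable.measurable_mk
  · exact ae_all_iff.2 fun n => (ha.hasLaw n).aemeasurable.ae_eq_mk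

end Sequence

/-! ### Gaussian series in a Hilbert space -/

section Hilbert

variable {Ω : Type*} [mΩ : MeasurableSpace Ω] {P : Measure Ω} {a : ℕ → Ω → ℂ}
  {H : Type*} [NormedAddCommGroup H] [InnerProductSpace ℂ H]

/-- The filtration whose `m`-th `σ`-algebra is generated by `a 0, …, a (m - 1)`. -/
def pastFiltration (a : ℕ → Ω → ℂ) (hm : ∀ n, Measurable (a n)) : Filtration ℕ mΩ where
  seq m := ⨆ k ∈ {k : ℕ | k < m}, MeasurableSpace.comap (a k) inferInstance
  mono' _ _ hij := biSup_mono fun _ hk => lt_of_lt_of_le hk hij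
  le' _ := iSup₂_le fun k _ => (hm k).comap_le

theorem measurable_pastFiltration (hm : ∀ n, Measurable (a n)) {k m : ℕ} (h : k < m) :
    Measurable[pastFiltration a hm m] (a k) :=
  measurable_iff_comap_le.2
    (le_biSup (fun k => MeasurableSpace.comap (a k) (inferInstance : MeasurableSpace ℂ)) h)

theorem indep_pastFiltration (ha : IsStdComplexGaussianSeq P a) (hm : ∀ n, Measurable (a n))
    (m : ℕ) : Indep (MeasurableSpace.comap (a m) inferInstance) (pastFiltration a hm m) P := by
  suffices Indep (⨆ k ∈ ({m} : Set ℕ), MeasurableSpace.comap (a k) inferInstance)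
      (⨆ k ∈ {k | k < m}, MeasurableSpace.comap (a k) inferInstance) P by
    rwa [iSup_singleton] at this
  exact indep_iSup_of_disjoint (fun k => (hm k).comap_le) ha.indep (by simp)

theorem indepFun_of_pastFiltration (ha : IsStdComplexGaussianSeq P a) (hm : ∀ n, Measurable (a n))
    {m : ℕ} {β : Type*} [MeasurableSpace β] {w : Ω → β}
    (hw : Measurable[pastFiltration a hm m] w) : IndepFun (a m) w P :=
  (IndepFun_iff_Indep _ _ _).2
    (indep_of_indep_of_le_right (indep_pastFiltration ha hm m) (measurable_iff_comap_le.1 hw))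

/-- A variable of the sequence has zero mean against every function of the preceding ones. -/
theorem integral_mul_past (ha : IsStdComplexGaussianSeq P a) (hm : ∀ n, Measurable (a n))
    {m : ℕ} {w : Ω → ℂ} (hw : Measurable[pastFiltration a hm m] w) :
    ∫ ω, a m ω * w ω ∂P = 0 := by
  have h := (indepFun_of_pastFiltration ha hm hw).integral_fun_mul_eq_mul_integral
    (hm m).aestronglyMeasurable (hw.mono ((pastFiltration a hm).le m) le_rfl).aestronglyMeasurable
  rw [h, ha.integral_eq_zero, zero_mul]

theorem stronglyMeasurable_sum_smul (hm : ∀ n, Measurable (a n)) (v : ℕ → H) {s : Finset ℕ} {m : ℕ}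
    (hs : ∀ n ∈ s, n < m) :
    StronglyMeasurable[pastFiltration a hm m] (fun ω => ∑ n ∈ s, a n ω • v n) :=
  Finset.stronglyMeasurable_fun_sum _ fun n hn =>
    ((measurable_pastFiltration hm (hs n hn)).stronglyMeasurable).smul_const (v n)

theorem memLp_sum_smul (ha : IsStdComplexGaussianSeq P a) (v : ℕ → H) (s : Finset ℕ) :
    MemLp (fun ω => ∑ n ∈ s, a n ω • v n) 4 P := by
  refine memLp_finsetSum s fun n _ => ?_
  refine (ha.memLp n).of_le_mul (c := ‖v n‖)
    ((ha.memLp n).aestronglyMeasurable.smul_const (v n)) (ae_of_all _ fun ω => ?_)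
  rw [norm_smul, mul_comm]

theorem norm_add_smul_sq (x v : H) (z : ℂ) :
    ‖x + z • v‖ ^ 2 = ‖x‖ ^ 2 + 2 * (z * inner ℂ x v).re + ‖z‖ ^ 2 * ‖v‖ ^ 2 := by
  rw [@norm_add_sq ℂ, inner_smul_right, norm_smul, mul_pow]
  rfl

section

variable [IsProbabilityMeasure P]

theorem integrable_norm_sq_sum (ha : IsStdComplexGaussianSeq P a) (v : ℕ → H) (s : Finset ℕ) :
    Integrable (fun ω => ‖∑ n ∈ s, a n ω • v n‖ ^ 2) P :=
  MemLp.integrable_norm_pow (p := 2)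
    ((memLp_sum_smul ha v s).mono_exponent (by norm_num)) (by norm_num)

theorem integrable_inner_sum (ha : IsStdComplexGaussianSeq P a) (v : ℕ → H) (s : Finset ℕ) (x : H) :
    Integrable (fun ω => inner ℂ (∑ n ∈ s, a n ω • v n) x) P := by
  refine ((memLp_sum_smul ha v s).integrable (by norm_num)).norm.mul_const ‖x‖ |>.mono'
    ?_ (ae_of_all _ fun ω => norm_inner_le_norm _ _)
  exact ((memLp_sum_smul ha v s).aestronglyMeasurable).inner aestronglyMeasurable_const

/-- The cross term between the partial sum and the next summand has zero mean on every event
of the past. -/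
theorem setIntegral_cross_eq_zero (ha : IsStdComplexGaussianSeq P a) (hm : ∀ n, Measurable (a n))
    (v : ℕ → H) {s : Finset ℕ} {m : ℕ} (hs : ∀ n ∈ s, n < m) {A : Set Ω}
    (hA : MeasurableSet[pastFiltration a hm m] A) :
    IntegrableOn (fun ω => (a m ω * inner ℂ (∑ n ∈ s, a n ω • v n) (v m)).re) A P ∧
    ∫ ω in A, (a m ω * inner ℂ (∑ n ∈ s, a n ω • v n) (v m)).re ∂P = 0 := by
  have hA' : MeasurableSet A := (pastFiltration a hm).le m _ hA
  have hw0 : StronglyMeasurable[pastFiltration a hm m]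
      (fun ω => inner ℂ (∑ n ∈ s, a n ω • v n) (v m)) :=
    (stronglyMeasurable_sum_smul hm v hs).inner stronglyMeasurable_const
  have hw : Measurable[pastFiltration a hm m]
      (A.indicator fun ω => inner ℂ (∑ n ∈ s, a n ω • v n) (v m)) :=
    (hw0.measurable).indicator hA
  have hint : Integrable (fun ω => a m ω * inner ℂ (∑ n ∈ s, a n ω • v n) (v m)) P :=
    (indepFun_of_pastFiltration ha hm hw0.measurable).integrable_mul
      ((ha.memLp m).integrable (by norm_num)) (integrable_inner_sum ha v s (v m))
  refine ⟨hint.integrableOn.re, ?_⟩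
  have h := integral_mul_past ha hm hw
  have h2 : (fun ω => a m ω * A.indicator (fun ω => inner ℂ (∑ n ∈ s, a n ω • v n) (v m)) ω) =
      A.indicator (fun ω => a m ω * inner ℂ (∑ n ∈ s, a n ω • v n) (v m)) := by
    funext ω
    by_cases hω : ω ∈ A <;> simp [hω]
  rw [h2, integral_indicator hA'] at h
  have h3 := integral_re hint.integrableOn (μ := P.restrict A)
  rw [h] at h3
  simpa using h3

theorem integral_norm_sq_sum (ha : IsStdComplexGaussianSeq P a) (hm : ∀ n, Measurable (a n))
    (v : ℕ → H) (k m : ℕ) :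
    ∫ ω, ‖∑ n ∈ Finset.Ico k m, a n ω • v n‖ ^ 2 ∂P = ∑ n ∈ Finset.Ico k m, ‖v n‖ ^ 2 := by
  rcases le_total m k with hmk | hkm
  · simp [Finset.Ico_eq_empty_of_le hmk]
  induction m, hkm using Nat.le_induction with
  | base => simp
  | succ m hkm ih =>
    simp_rw [Finset.sum_Ico_succ_top hkm, norm_add_smul_sq]
    have hlt : ∀ n ∈ Finset.Ico k m, n < m := fun n hn => (Finset.mem_Ico.1 hn).2
    obtain ⟨h1, h2⟩ := setIntegral_cross_eq_zero ha hm v hlt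
      (@MeasurableSet.univ _ (pastFiltration a hm m))
    rw [integrableOn_univ] at h1
    rw [setIntegral_univ] at h2
    have h3 : Integrable (fun ω => ‖a m ω‖ ^ 2) P :=
      MemLp.integrable_norm_pow (p := 2) ((ha.memLp m).mono_exponent (by norm_num)) (by norm_num)
    have h0 := integrable_norm_sq_sum ha v (Finset.Ico k m)
    rw [integral_add (h0.fun_add (h1.const_mul 2)) (h3.mul_const _), integral_add h0 (h1.const_mul 2),
      integral_const_mul, h2, integral_mul_const, ha.integral_norm_sq, ih]
    ring

theorem fourthMoment_nonneg : 0 ≤ fourthMoment := integral_nonneg fun _ => by positivity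

/-- Fourth moments of a Gaussian sum in a Hilbert space are controlled by the square of its
variance. -/
theorem integral_norm_pow_four_sum_le (ha : IsStdComplexGaussianSeq P a)
    (hm : ∀ n, Measurable (a n)) (v : ℕ → H) (m : ℕ) :
    ∫ ω, ‖∑ n ∈ Finset.range m, a n ω • v n‖ ^ 4 ∂P ≤
      (4 + 3 * fourthMoment) * (∑ n ∈ Finset.range m, ‖v n‖ ^ 2) ^ 2 := by
  have hκ := fourthMoment_nonneg
  induction m with
  | zero => simp
  | succ m ih =>
    set S : Ω → H := fun ω => ∑ n ∈ Finset.range m, a n ω • v n with hS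
    have hlt : ∀ n ∈ Finset.range m, n < m := fun n hn => Finset.mem_range.1 hn
    have hSm : StronglyMeasurable[pastFiltration a hm m] S := stronglyMeasurable_sum_smul hm v hlt
    have hSL : MemLp S 4 P := memLp_sum_smul ha v _
    have hp : Integrable (fun ω => ‖S ω‖ ^ 2) P := integrable_norm_sq_sum ha v _
    have hp2 : Integrable (fun ω => ‖S ω‖ ^ 4) P :=
      MemLp.integrable_norm_pow (p := 4) hSL (by norm_num)
    have hb2 : Integrable (fun ω => ‖a m ω‖ ^ 2) P :=
      MemLp.integrable_norm_pow (p := 2) ((ha.memLp m).mono_exponent (by norm_num)) (by norm_num)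
    have hb4 : Integrable (fun ω => ‖a m ω‖ ^ 4) P :=
      MemLp.integrable_norm_pow (p := 4) (ha.memLp m) (by norm_num)
    -- the mixed term of degree two in both factors
    have hpast2 : Measurable[pastFiltration a hm m] (fun ω => ‖S ω‖ ^ 2) :=
      (hSm.norm.pow 2).measurable
    have hind2 : IndepFun (fun ω => ‖a m ω‖ ^ 2) (fun ω => ‖S ω‖ ^ 2) P :=
      (indepFun_of_pastFiltration ha hm hpast2).comp (φ := fun z : ℂ => ‖z‖ ^ 2) (ψ := id)
        (by fun_prop) measurable_id
    have hpq : Integrable (fun ω => ‖a m ω‖ ^ 2 * ‖S ω‖ ^ 2) P := hind2.integrable_mul hb2 hp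
    have hpqE : ∫ ω, ‖a m ω‖ ^ 2 * ‖S ω‖ ^ 2 ∂P = ∑ n ∈ Finset.range m, ‖v n‖ ^ 2 := by
      rw [hind2.integral_fun_mul_eq_mul_integral hb2.1 hp.1, ha.integral_norm_sq, one_mul]
      have := integral_norm_sq_sum ha hm v 0 m
      rwa [← Finset.range_eq_Ico] at this
    -- the term of degree one in the new variable has mean zero
    have hwm : StronglyMeasurable[pastFiltration a hm m]
        (fun ω => ((‖S ω‖ ^ 2 : ℝ) : ℂ) * inner ℂ (S ω) (v m)) :=
      (Complex.continuous_ofReal.comp_stronglyMeasurable (hSm.norm.pow 2)).mul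
        (hSm.inner stronglyMeasurable_const)
    have hwi : Integrable (fun ω => ((‖S ω‖ ^ 2 : ℝ) : ℂ) * inner ℂ (S ω) (v m)) P := by
      have h3 : Integrable (fun ω => ‖S ω‖ ^ 3) P :=
        MemLp.integrable_norm_pow (p := 3) (hSL.mono_exponent (by norm_num)) (by norm_num)
      refine (h3.mul_const ‖v m‖).mono'
        (hwm.mono ((pastFiltration a hm).le m)).aestronglyMeasurable (ae_of_all _ fun ω => ?_)
      rw [norm_mul, Complex.norm_real, norm_pow, norm_norm]
      calc ‖S ω‖ ^ 2 * ‖inner ℂ (S ω) (v m)‖ ≤ ‖S ω‖ ^ 2 * (‖S ω‖ * ‖v m‖) := by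
            gcongr; exact norm_inner_le_norm _ _
        _ = ‖S ω‖ ^ 3 * ‖v m‖ := by ring
    have hpr : Integrable
        (fun ω => a m ω * (((‖S ω‖ ^ 2 : ℝ) : ℂ) * inner ℂ (S ω) (v m))) P :=
      (indepFun_of_pastFiltration ha hm hwm.measurable).integrable_mul
        ((ha.memLp m).integrable (by norm_num)) hwi
    have hprE : ∫ ω, (a m ω * (((‖S ω‖ ^ 2 : ℝ) : ℂ) * inner ℂ (S ω) (v m))).re ∂P = 0 := by
      have h3 := integral_re hpr
      rw [integral_mul_past ha hm hwm.measurable] at h3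
      simpa using h3
    have hpr' := hpr.re
    simp only [RCLike.re_to_complex] at hpr'
    have hpt : ∀ ω, ‖S ω + a m ω • v m‖ ^ 4 ≤ ‖S ω‖ ^ 4
        + 8 * ‖v m‖ ^ 2 * (‖a m ω‖ ^ 2 * ‖S ω‖ ^ 2) + 3 * ‖v m‖ ^ 4 * ‖a m ω‖ ^ 4
        + 4 * (a m ω * (((‖S ω‖ ^ 2 : ℝ) : ℂ) * inner ℂ (S ω) (v m))).re := by
      intro ω
      have h4 : ‖S ω + a m ω • v m‖ ^ 4 = (‖S ω + a m ω • v m‖ ^ 2) ^ 2 := by ring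
      rw [h4, norm_add_smul_sq]
      have h5 : (a m ω * (((‖S ω‖ ^ 2 : ℝ) : ℂ) * inner ℂ (S ω) (v m))).re =
          ‖S ω‖ ^ 2 * (a m ω * inner ℂ (S ω) (v m)).re := by
        rw [← Complex.re_ofReal_mul]
        congr 1
        ring
      rw [h5]
      set r := (a m ω * inner ℂ (S ω) (v m)).re
      have h6 : r ^ 2 ≤ ‖S ω‖ ^ 2 * (‖a m ω‖ ^ 2 * ‖v m‖ ^ 2) := by
        have : |r| ≤ ‖a m ω‖ * (‖S ω‖ * ‖v m‖) :=
          (Complex.abs_re_le_norm _).trans (by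
            rw [norm_mul]; gcongr; exact norm_inner_le_norm _ _)
        calc r ^ 2 = |r| ^ 2 := (sq_abs r).symm
          _ ≤ (‖a m ω‖ * (‖S ω‖ * ‖v m‖)) ^ 2 := by gcongr
          _ = _ := by ring
      set q := ‖a m ω‖ ^ 2 * ‖v m‖ ^ 2 with hq
      have h7 : ‖v m‖ ^ 4 * ‖a m ω‖ ^ 4 = q ^ 2 := by rw [hq]; ring
      nlinarith [sq_nonneg (r - q)]
    simp_rw [Finset.sum_range_succ]
    calc ∫ ω, ‖S ω + a m ω • v m‖ ^ 4 ∂P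
        ≤ ∫ ω, (‖S ω‖ ^ 4 + 8 * ‖v m‖ ^ 2 * (‖a m ω‖ ^ 2 * ‖S ω‖ ^ 2)
          + 3 * ‖v m‖ ^ 4 * ‖a m ω‖ ^ 4
          + 4 * (a m ω * (((‖S ω‖ ^ 2 : ℝ) : ℂ) * inner ℂ (S ω) (v m))).re) ∂P := by
          refine integral_mono_of_nonneg (ae_of_all _ fun ω => by positivity) ?_ (ae_of_all _ hpt)
          exact ((hp2.fun_add (hpq.const_mul _)).fun_add (hb4.const_mul _)).fun_add (hpr'.const_mul 4)
      _ = ∫ ω, ‖S ω‖ ^ 4 ∂P + 8 * ‖v m‖ ^ 2 * (∑ n ∈ Finset.range m, ‖v n‖ ^ 2)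
          + 3 * ‖v m‖ ^ 4 * fourthMoment := by
          rw [integral_add ((hp2.fun_add (hpq.const_mul _)).fun_add (hb4.const_mul _)) (hpr'.const_mul 4),
            integral_add (hp2.fun_add (hpq.const_mul _)) (hb4.const_mul _),
            integral_add hp2 (hpq.const_mul _), integral_const_mul, integral_const_mul,
            integral_const_mul, hprE, hpqE, ha.integral_norm_pow_four]
          ring
      _ ≤ (4 + 3 * fourthMoment) * (∑ n ∈ Finset.range m, ‖v n‖ ^ 2 + ‖v m‖ ^ 2) ^ 2 := by
          set s := ∑ n ∈ Finset.range m, ‖v n‖ ^ 2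
          have hs : 0 ≤ s := Finset.sum_nonneg fun n _ => by positivity
          have hv : 0 ≤ ‖v m‖ ^ 2 := by positivity
          have h8 : ‖v m‖ ^ 4 = (‖v m‖ ^ 2) ^ 2 := by ring
          rw [h8]
          nlinarith [mul_nonneg hκ (mul_nonneg hs hv), sq_nonneg (‖v m‖ ^ 2)]

/-- The squared norms of the partial sums form a submartingale. -/
theorem submartingale_norm_sq_sum (ha : IsStdComplexGaussianSeq P a) (hm : ∀ n, Measurable (a n))
    (v : ℕ → H) (k : ℕ) :
    Submartingale (fun m ω => ‖∑ n ∈ Finset.Ico k m, a n ω • v n‖ ^ 2) (pastFiltration a hm) P := by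
  have hlt : ∀ m, ∀ n ∈ Finset.Ico k m, n < m := fun m n hn => (Finset.mem_Ico.1 hn).2
  refine submartingale_of_setIntegral_le_succ
    (fun m => (stronglyMeasurable_sum_smul hm v (hlt m)).norm.pow 2)
    (fun m => integrable_norm_sq_sum ha v _) fun m A hA => ?_
  rcases lt_or_ge m k with hmk | hkm
  · simp [Finset.Ico_eq_empty_of_le hmk.le, Finset.Ico_eq_empty_of_le (Nat.succ_le_of_lt hmk)]
  obtain ⟨h1, h2⟩ := setIntegral_cross_eq_zero ha hm v (hlt m) hA
  have h0 := (integrable_norm_sq_sum ha v (Finset.Ico k m)).integrableOn (s := A)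
  calc ∫ ω in A, ‖∑ n ∈ Finset.Ico k m, a n ω • v n‖ ^ 2 ∂P
      = ∫ ω in A, (‖∑ n ∈ Finset.Ico k m, a n ω • v n‖ ^ 2
          + 2 * (a m ω * inner ℂ (∑ n ∈ Finset.Ico k m, a n ω • v n) (v m)).re) ∂P := by
        rw [integral_add h0 (h1.const_mul 2), integral_const_mul, h2]
        ring
    _ ≤ _ := by
        refine setIntegral_mono (h0.fun_add (h1.const_mul 2))
          (integrable_norm_sq_sum ha v _).integrableOn fun ω => ?_
        simp only [Finset.sum_Ico_succ_top hkm, norm_add_smul_sq]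
        have : 0 ≤ ‖a m ω‖ ^ 2 * ‖v m‖ ^ 2 := by positivity
        linarith

end

end Hilbert

section Hilbert

variable {Ω : Type*} [mΩ : MeasurableSpace Ω] {P : Measure Ω} [IsProbabilityMeasure P]
  {a : ℕ → Ω → ℂ} {H : Type*} [NormedAddCommGroup H] [InnerProductSpace ℂ H]

/-- Kolmogorov's maximal inequality for a block of the series. -/
theorem measure_exists_norm_sq_ge_le (ha : IsStdComplexGaussianSeq P a)
    (hm : ∀ n, Measurable (a n)) {v : ℕ → H} (hv : Summable fun n => ‖v n‖ ^ 2) (k : ℕ)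
    {ε : NNReal} (hε : ε ≠ 0) :
    P {ω | ∃ m, (ε : ℝ) ≤ ‖∑ n ∈ Finset.Ico k m, a n ω • v n‖ ^ 2} ≤
      ENNReal.ofReal (∑' n, ‖v (n + k)‖ ^ 2) / ε := by
  have hset : {ω | ∃ m, (ε : ℝ) ≤ ‖∑ n ∈ Finset.Ico k m, a n ω • v n‖ ^ 2} =
      ⋃ M : ℕ, {ω | ∃ m ≤ M, (ε : ℝ) ≤ ‖∑ n ∈ Finset.Ico k m, a n ω • v n‖ ^ 2} := by
    ext ω
    simp only [Set.mem_ofPred_eq, Set.mem_iUnion]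
    exact ⟨fun ⟨m, h⟩ => ⟨m, m, le_rfl, h⟩, fun ⟨_, m, _, h⟩ => ⟨m, h⟩⟩
  have hmono : Monotone fun M : ℕ =>
      {ω | ∃ m ≤ M, (ε : ℝ) ≤ ‖∑ n ∈ Finset.Ico k m, a n ω • v n‖ ^ 2} :=
    fun M M' h ω ⟨m, hm, h'⟩ => ⟨m, hm.trans h, h'⟩
  rw [hset, hmono.measure_iUnion]
  refine iSup_le fun M => ?_
  have hmax := maximal_ineq (submartingale_norm_sq_sum ha hm v k)
    (fun m ω => by positivity) (ε := ε) M
  have hset' : {ω | (ε : ℝ) ≤ (Finset.range (M + 1)).sup' Finset.nonempty_range_add_one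
      fun m => ‖∑ n ∈ Finset.Ico k m, a n ω • v n‖ ^ 2} =
      {ω | ∃ m ≤ M, (ε : ℝ) ≤ ‖∑ n ∈ Finset.Ico k m, a n ω • v n‖ ^ 2} := by
    ext ω
    simp [Finset.le_sup'_iff]
  rw [hset'] at hmax
  rw [ENNReal.le_div_iff_mul_le (Or.inl (by simpa using hε)) (Or.inl (by simp)), mul_comm]
  refine hmax.trans (ENNReal.ofReal_le_ofReal ?_)
  refine (setIntegral_le_integral (integrable_norm_sq_sum ha v _)
    (ae_of_all _ fun ω => by positivity)).trans ?_
  rw [integral_norm_sq_sum ha hm, Finset.sum_Ico_eq_sum_range]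
  simp_rw [add_comm k]
  exact ((summable_nat_add_iff k).2 hv).sum_le_tsum _ fun n _ => by positivity

/-- A Gaussian series in a Hilbert space with square summable coefficients has almost surely
Cauchy partial sums. -/
theorem ae_cauchySeq_sum_smul (ha : IsStdComplexGaussianSeq P a) {v : ℕ → H}
    (hv : Summable fun n => ‖v n‖ ^ 2) :
    ∀ᵐ ω ∂P, CauchySeq fun m => ∑ n ∈ Finset.range m, a n ω • v n := by
  obtain ⟨b, hb, hbm, hab⟩ := ha.exists_measurable
  have htail : Tendsto (fun k => ∑' n, ‖v (n + k)‖ ^ 2) atTop (𝓝 0) :=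
    tendsto_sum_nat_add fun n => ‖v n‖ ^ 2
  have key : ∀ j : ℕ, ∀ᵐ ω ∂P, ∃ k, ∀ m,
      ‖∑ n ∈ Finset.Ico k m, b n ω • v n‖ ^ 2 < 1 / ((j : ℝ) + 1) := by
    intro j
    set ε : NNReal := 1 / ((j : NNReal) + 1) with hεdef
    have hε : ε ≠ 0 := by positivity
    have hεr : (ε : ℝ) = 1 / ((j : ℝ) + 1) := by simp [hεdef]
    rw [ae_iff]
    have hlim : Tendsto (fun k => ENNReal.ofReal (∑' n, ‖v (n + k)‖ ^ 2) / ε) atTop (𝓝 0) := by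
      have h1 := ENNReal.Tendsto.div_const (ENNReal.tendsto_ofReal htail) (b := (ε : ENNReal))
        (Or.inr (by simpa using hε))
      simpa using h1
    refine le_antisymm (ge_of_tendsto' hlim fun k => ?_) bot_le
    refine (measure_mono fun ω hω => ?_).trans (measure_exists_norm_sq_ge_le hb hbm hv k hε)
    simp only [Set.mem_ofPred_eq, not_exists, not_forall, not_lt] at hω
    rw [Set.mem_ofPred_eq, hεr]
    exact hω k
  filter_upwards [ae_all_iff.2 key, hab] with ω hω hω'
  simp_rw [hω']
  rw [Metric.cauchySeq_iff']
  intro ε hε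
  obtain ⟨j, hj⟩ := exists_nat_one_div_lt (show 0 < ε ^ 2 by positivity)
  obtain ⟨k, hk⟩ := hω j
  refine ⟨k, fun m hm => ?_⟩
  rw [dist_eq_norm, ← Finset.sum_Ico_eq_sub _ hm]
  exact lt_of_pow_lt_pow_left₀ 2 hε.le ((hk m).trans hj)

/-- Fatou's lemma for the fourth moment of a Gaussian series in a Hilbert space. -/
theorem lintegral_liminf_norm_pow_four_le (ha : IsStdComplexGaussianSeq P a)
    (hm : ∀ n, Measurable (a n)) {v : ℕ → H} {s : ℝ}
    (hv : ∀ m, ∑ n ∈ Finset.range m, ‖v n‖ ^ 2 ≤ s) :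
    ∫⁻ ω, liminf (fun m => ENNReal.ofReal (‖∑ n ∈ Finset.range m, a n ω • v n‖ ^ 4)) atTop ∂P ≤
      ENNReal.ofReal ((4 + 3 * fourthMoment) * s ^ 2) := by
  have hκ := fourthMoment_nonneg
  have hmeas : ∀ m, Measurable fun ω =>
      ENNReal.ofReal (‖∑ n ∈ Finset.range m, a n ω • v n‖ ^ 4) := fun m =>
    ENNReal.measurable_ofReal.comp ((Finset.stronglyMeasurable_fun_sum _ fun n _ =>
      ((hm n).stronglyMeasurable).smul_const (v n)).norm.pow 4).measurable
  refine (lintegral_liminf_le hmeas).trans ?_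
  refine liminf_le_of_le (by isBoundedDefault) fun b hb => ?_
  obtain ⟨m, hbm⟩ := hb.exists
  refine hbm.trans ?_
  rw [← ofReal_integral_eq_lintegral_ofReal
    (MemLp.integrable_norm_pow (p := 4) (memLp_sum_smul ha v _) (by norm_num))
    (ae_of_all _ fun ω => by positivity)]
  refine ENNReal.ofReal_le_ofReal ((integral_norm_pow_four_sum_le ha hm v m).trans ?_)
  have : 0 ≤ ∑ n ∈ Finset.range m, ‖v n‖ ^ 2 := Finset.sum_nonneg fun n _ => by positivity
  gcongr
  exact hv m

/-- A Borel–Cantelli argument: a sequence of Gaussian series whose variances are square summable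
tends to zero almost surely. -/
theorem ae_tendsto_liminf_norm_pow_four (ha : IsStdComplexGaussianSeq P a) {v : ℕ → ℕ → H}
    {s : ℕ → ℝ} (hs : Summable fun L => s L ^ 2)
    (hv : ∀ L m, ∑ n ∈ Finset.range m, ‖v L n‖ ^ 2 ≤ s L) :
    ∀ᵐ ω ∂P, Tendsto (fun L => liminf (fun m =>
      ENNReal.ofReal (‖∑ n ∈ Finset.range m, a n ω • v L n‖ ^ 4)) atTop) atTop (𝓝 0) := by
  obtain ⟨b, hb, hbm, hab⟩ := ha.exists_measurable
  have hκ := fourthMoment_nonneg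
  have hmeas : ∀ L, Measurable fun ω => liminf (fun m =>
      ENNReal.ofReal (‖∑ n ∈ Finset.range m, b n ω • v L n‖ ^ 4)) atTop := fun L =>
    .liminf fun m => ENNReal.measurable_ofReal.comp
      ((Finset.stronglyMeasurable_fun_sum _ fun n _ =>
        ((hbm n).stronglyMeasurable).smul_const (v L n)).norm.pow 4).measurable
  have hfin : ∫⁻ ω, ∑' L, liminf (fun m =>
      ENNReal.ofReal (‖∑ n ∈ Finset.range m, b n ω • v L n‖ ^ 4)) atTop ∂P ≠ ⊤ := by
    rw [lintegral_tsum fun L => (hmeas L).aemeasurable]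
    refine ne_top_of_le_ne_top ?_ (ENNReal.tsum_le_tsum fun L =>
      lintegral_liminf_norm_pow_four_le hb hbm (hv L))
    rw [← ENNReal.ofReal_tsum_of_nonneg (fun L => by positivity) (hs.mul_left _)]
    exact ENNReal.ofReal_ne_top
  have hae := ae_lt_top (Measurable.tsum hmeas) hfin
  filter_upwards [hae, hab] with ω hω hω'
  simp_rw [hω']
  exact ENNReal.tendsto_atTop_zero_of_tsum_ne_top hω.ne

end Hilbert

/-! ### Expansion coefficients in an orthonormal basis -/

theorem integrable_mul_conj_basis (e : L2Basis) {s : ℝ → ℂ} (hs : MemLp s 2 volume) (n : ℕ) :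
    Integrable fun t => s t * conj ((e n : ℝ → ℂ) t) :=
  hs.integrable_mul (Lp.memLp (e n)).star

theorem coeff_eq_inner (e : L2Basis) {s : ℝ → ℂ} (hs : MemLp s 2 volume) (n : ℕ) :
    coeff e s n = inner ℂ (e n) (hs.toLp s) := by
  rw [L2.inner_def, coeff]
  refine integral_congr_ae ?_
  filter_upwards [hs.coeFn_toLp] with t ht
  rw [ht]
  simp [RCLike.inner_apply]

theorem coeff_const_mul (e : L2Basis) (z : ℂ) (s : ℝ → ℂ) (n : ℕ) :
    coeff e (fun t => z * s t) n = z * coeff e s n := by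
  rw [coeff, coeff, ← integral_const_mul]
  simp_rw [mul_assoc]

theorem coeff_sub (e : L2Basis) {s r : ℝ → ℂ} (hs : MemLp s 2 volume) (hr : MemLp r 2 volume)
    (n : ℕ) : coeff e (fun t => s t - r t) n = coeff e s n - coeff e r n := by
  rw [coeff, coeff, coeff, ← integral_sub (integrable_mul_conj_basis e hs n)
    (integrable_mul_conj_basis e hr n)]
  simp_rw [sub_mul]

theorem coeff_sum {ι : Type*} (e : L2Basis) (F : Finset ι) {s : ι → ℝ → ℂ} (z : ι → ℂ)
    (hs : ∀ i ∈ F, MemLp (s i) 2 volume) (n : ℕ) :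
    coeff e (fun t => ∑ i ∈ F, z i * s i t) n = ∑ i ∈ F, z i * coeff e (s i) n := by
  simp_rw [← coeff_const_mul]
  simp_rw [coeff, Finset.sum_mul]
  refine integral_finsetSum _ fun i hi => ?_
  exact integrable_mul_conj_basis e ((hs i hi).const_mul (z i)) n

theorem norm_toLp_sq {α : Type*} [MeasurableSpace α] {μ : Measure α} {s : α → ℂ}
    (hs : MemLp s 2 μ) : ‖hs.toLp s‖ ^ 2 = ∫ t, ‖s t‖ ^ 2 ∂μ := by
  have h := @inner_self_eq_norm_sq_to_K ℂ _ _ _ _ (hs.toLp s)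
  rw [L2.inner_def] at h
  have h2 : ∫ t, inner ℂ ((hs.toLp s : α → ℂ) t) ((hs.toLp s : α → ℂ) t) ∂μ =
      ((∫ t, ‖s t‖ ^ 2 ∂μ : ℝ) : ℂ) := by
    rw [← integral_complex_ofReal]
    refine integral_congr_ae ?_
    filter_upwards [hs.coeFn_toLp] with t ht
    rw [ht, inner_self_eq_norm_sq_to_K]
    simp
  rw [h2] at h
  exact Complex.ofReal_injective (by simpa using h.symm)

/-- Parseval's identity. -/
theorem hasSum_norm_sq_coeff (e : L2Basis) {s : ℝ → ℂ} (hs : MemLp s 2 volume) :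
    HasSum (fun n => ‖coeff e s n‖ ^ 2) (∫ t, ‖s t‖ ^ 2) := by
  have h := e.hasSum_inner_mul_inner (hs.toLp s) (hs.toLp s)
  have h2 := (Complex.hasSum_re h)
  rw [← norm_toLp_sq hs, @norm_sq_eq_re_inner ℂ]
  refine h2.congr_fun fun n => ?_
  rw [coeff_eq_inner e hs, ← inner_conj_symm (hs.toLp s) (e n), Complex.conj_mul',
    ← Complex.ofReal_pow, Complex.ofReal_re]

/-- Bessel's inequality. -/
theorem sum_norm_sq_coeff_le (e : L2Basis) {s : ℝ → ℂ} (hs : MemLp s 2 volume) (F : Finset ℕ) :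
    ∑ n ∈ F, ‖coeff e s n‖ ^ 2 ≤ ∫ t, ‖s t‖ ^ 2 :=
  sum_le_hasSum F (fun _ _ => by positivity) (hasSum_norm_sq_coeff e hs)

/-! ### Control on a disc by the mean square on a circle -/

/-- Lebesgue measure on the parameter interval of a circle. -/
abbrev circleMeasure : Measure ℝ := volume.restrict (Set.Ioc 0 (2 * Real.pi))

theorem memLp_circle {g : ℝ → ℂ} (hg : Continuous g) : MemLp g 2 circleMeasure := by
  obtain ⟨C, hC⟩ := (isCompact_Icc (a := (0 : ℝ)) (b := 2 * Real.pi)).exists_bound_of_continuousOn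
    hg.continuousOn
  refine MemLp.of_bound hg.aestronglyMeasurable C ?_
  filter_upwards [ae_restrict_mem measurableSet_Ioc] with θ hθ
  exact hC θ (Set.Ioc_subset_Icc_self hθ)

/-- For a family `h z` of square integrable functions depending antiholomorphically on `z`, the
coefficients restricted to a circle are vectors of a Hilbert space whose squared norms have a
bounded sum, and which dominate the coefficients in the concentric disc of half the radius: this is
Cauchy's integral formula. -/
theorem exists_circle_vectors (e : L2Basis) {h : ℂ → ℝ → ℂ} {c : ℂ} {R B : ℝ} (hR : 0 < R)
    (hc : Metric.closedBall c R ⊆ halfPlane)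
    (hL : ∀ z ∈ halfPlane, MemLp (h z) 2 volume)
    (hB : ∀ z ∈ Metric.closedBall c R, ∫ t, ‖h z t‖ ^ 2 ≤ B)
    (hd : ∀ n, DifferentiableOn ℂ (fun z => conj (coeff e (h z) n)) halfPlane) :
    ∃ v : ℕ → Lp ℂ 2 circleMeasure, (∀ m, ∑ n ∈ Finset.range m, ‖v n‖ ^ 2 ≤ 2 * Real.pi * B) ∧
      ∀ z ∈ Metric.closedBall c (R / 2), ∀ (x : ℕ → ℂ) (F : Finset ℕ),
        ‖∑ n ∈ F, x n * coeff e (h z) n‖ ≤ ‖∑ n ∈ F, x n • v n‖ := by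
  have hmem : ∀ θ, circleMap c R θ ∈ Metric.closedBall c R := fun θ =>
    circleMap_mem_closedBall c hR.le θ
  have hcont : ∀ n, Continuous fun θ => conj (coeff e (h (circleMap c R θ)) n) := fun n =>
    (hd n).continuousOn.comp_continuous (continuous_circleMap c R) fun θ => hc (hmem θ)
  have hcont' : ∀ n, Continuous fun θ => coeff e (h (circleMap c R θ)) n := fun n => by
    simpa [Function.comp_def] using Complex.continuous_conj.comp (hcont n)
  refine ⟨fun n => (memLp_circle (hcont' n)).toLp _, fun m => ?_, fun z hz x F => ?_⟩
  · simp_rw [norm_toLp_sq]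
    rw [← integral_finsetSum _ fun n _ => ?_]
    · have : 2 * Real.pi * B = ∫ _ : ℝ, B ∂circleMeasure := by
        simp [circleMeasure, Real.pi_pos.le]
      rw [this]
      refine integral_mono_of_nonneg (ae_of_all _ fun θ => ?_) (integrable_const B)
        (ae_of_all _ fun θ => ?_)
      · exact Finset.sum_nonneg fun n _ => by positivity
      · exact (sum_norm_sq_coeff_le e (hL _ (hc (hmem θ))) _).trans (hB _ (hmem θ))
    · exact (memLp_circle (hcont' n)).integrable_norm_pow (by norm_num)
  · have hzR : z ∈ Metric.ball c R := Metric.closedBall_subset_ball (by linarith) hz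
    have hdist : ∀ θ, R / 2 ≤ ‖circleMap c R θ - z‖ := by
      intro θ
      have h1 : ‖circleMap c R θ - c‖ = R := by simp [circleMap, hR.le]
      have h2 : ‖z - c‖ ≤ R / 2 := by simpa [dist_eq_norm] using hz
      have h3 := norm_sub_norm_le (circleMap c R θ - c) (z - c)
      rw [sub_sub_sub_cancel_right] at h3
      linarith
    have hne : ∀ θ, circleMap c R θ - z ≠ 0 := fun θ h0 => by
      have := hdist θ
      rw [h0, norm_zero] at this
      linarith
    -- Cauchy's kernel, as an element of the Hilbert space
    set κ : ℝ → ℂ := fun θ =>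
      (2 * Real.pi : ℂ)⁻¹ * ((circleMap 0 R θ) * (circleMap c R θ - z)⁻¹) with hκ
    have hκc : Continuous κ := by
      exact continuous_const.mul ((continuous_circleMap 0 R).mul
        (((continuous_circleMap c R).sub continuous_const).inv₀ hne))
    have hκb : ‖(memLp_circle hκc).toLp κ‖ ≤ 1 := by
      have hk : ∀ θ, ‖κ θ‖ ≤ Real.pi⁻¹ := by
        intro θ
        have h1 := hdist θ
        simp only [hκ, norm_mul, norm_inv, norm_circleMap_zero, abs_of_pos hR]
        rw [Complex.norm_ofNat, Complex.norm_real, Real.norm_of_nonneg Real.pi_pos.le]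
        have h2 : R * ‖circleMap c R θ - z‖⁻¹ ≤ 2 := by
          rw [← div_eq_mul_inv, div_le_iff₀ (by linarith)]
          linarith
        calc (2 * Real.pi)⁻¹ * (R * ‖circleMap c R θ - z‖⁻¹) ≤ (2 * Real.pi)⁻¹ * 2 := by
              gcongr
          _ = Real.pi⁻¹ := by field_simp
      have h3 : ‖(memLp_circle hκc).toLp κ‖ ^ 2 ≤ 1 := by
        rw [norm_toLp_sq]
        calc ∫ θ, ‖κ θ‖ ^ 2 ∂circleMeasure ≤ ∫ _ : ℝ, (Real.pi⁻¹) ^ 2 ∂circleMeasure := by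
              refine integral_mono_of_nonneg (ae_of_all _ fun θ => by positivity)
                (integrable_const _) (ae_of_all _ fun θ => ?_)
              have := hk θ
              simp only
              gcongr
          _ = 2 / Real.pi := by
              simp [circleMeasure, Real.pi_pos.le]
              field_simp
          _ ≤ 1 := by
              rw [div_le_one Real.pi_pos]
              exact Real.two_le_pi
      nlinarith [norm_nonneg ((memLp_circle hκc).toLp κ)]
    have hcauchy : ∀ n, coeff e (h z) n =
        inner ℂ ((memLp_circle hκc).toLp κ) ((memLp_circle (hcont' n)).toLp _) := by
      intro n
      have hdc : DifferentiableOn ℂ (fun z => conj (coeff e (h z) n)) (Metric.closedBall c R) :=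
        (hd n).mono hc
      have h1 := hdc.circleIntegral_sub_inv_smul hzR
      have h2 : inner ℂ ((memLp_circle (hcont' n)).toLp _) ((memLp_circle hκc).toLp κ) =
          conj (coeff e (h z) n) := by
        have h3 : conj (coeff e (h z) n) = (2 * Real.pi * I : ℂ)⁻¹ *
            ∮ w in C(c, R), (w - z)⁻¹ • conj (coeff e (h w) n) := by
          rw [h1, smul_eq_mul, inv_mul_cancel_left₀]
          simp [Real.pi_ne_zero]
        rw [h3, L2.inner_def, circleIntegral, intervalIntegral.integral_of_le (by positivity),
          ← integral_const_mul]
        refine integral_congr_ae ?_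
        filter_upwards [(memLp_circle hκc).coeFn_toLp, (memLp_circle (hcont' n)).coeFn_toLp]
          with θ h4 h5
        rw [h4, h5]
        simp only [hκ, deriv_circleMap, smul_eq_mul, RCLike.inner_apply]
        field_simp [Real.pi_ne_zero, I_ne_zero]
      rw [← inner_conj_symm, h2, Complex.conj_conj]
    calc ‖∑ n ∈ F, x n * coeff e (h z) n‖
        = ‖inner ℂ ((memLp_circle hκc).toLp κ)
            (∑ n ∈ F, x n • (memLp_circle (hcont' n)).toLp _)‖ := by
          rw [inner_sum]
          simp_rw [inner_smul_right, hcauchy]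
      _ ≤ ‖(memLp_circle hκc).toLp κ‖ * ‖∑ n ∈ F, x n • (memLp_circle (hcont' n)).toLp _‖ :=
          norm_inner_le_norm _ _
      _ ≤ 1 * ‖∑ n ∈ F, x n • (memLp_circle (hcont' n)).toLp _‖ := by gcongr
      _ = _ := one_mul _

/-! ### Complex Gamma integrals and the closed form of the wavelet -/

theorem integrableOn_rpow_mul_exp_neg_mul {s r : ℝ} (hs : 0 < s) (hr : 0 < r) :
    IntegrableOn (fun ξ : ℝ => ξ ^ (s - 1) * Real.exp (-(r * ξ))) (Set.Ioi 0) := by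
  have h := integrableOn_rpow_mul_exp_neg_mul_rpow (s := s - 1) (p := 1) (b := r)
    (by linarith) one_pos hr
  simpa using h

theorem norm_rpow_mul_cexp {ξ : ℝ} (hξ : 0 ≤ ξ) (p : ℝ) (w : ℂ) :
    ‖((ξ ^ p : ℝ) : ℂ) * cexp (-(w * ξ))‖ = ξ ^ p * Real.exp (-(w.re * ξ)) := by
  rw [norm_mul, Complex.norm_real, Real.norm_of_nonneg (Real.rpow_nonneg hξ _), Complex.norm_exp]
  simp

theorem aestronglyMeasurable_rpow_mul_cexp (p : ℝ) (w : ℂ) {μ : Measure ℝ} :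
    AEStronglyMeasurable (fun ξ : ℝ => ((ξ ^ p : ℝ) : ℂ) * cexp (-(w * ξ))) μ := by
  have : Measurable fun ξ : ℝ => ξ ^ p := by fun_prop
  exact ((Complex.measurable_ofReal.comp this).mul (by fun_prop)).aestronglyMeasurable

theorem integrableOn_rpow_mul_cexp {s : ℝ} (hs : 0 < s) {w : ℂ} (hw : 0 < w.re) :
    IntegrableOn (fun ξ : ℝ => ((ξ ^ (s - 1) : ℝ) : ℂ) * cexp (-(w * ξ))) (Set.Ioi 0) := by
  refine (integrableOn_rpow_mul_exp_neg_mul hs hw).mono'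
    (aestronglyMeasurable_rpow_mul_cexp _ _) ?_
  filter_upwards [ae_restrict_mem measurableSet_Ioi] with ξ hξ
  rw [norm_rpow_mul_cexp (le_of_lt hξ)]

theorem isOpen_rightHalfPlane : IsOpen {w : ℂ | 0 < w.re} :=
  isOpen_lt continuous_const Complex.continuous_re

theorem differentiableOn_integral_rpow_mul_cexp {s : ℝ} (hs : 0 < s) :
    DifferentiableOn ℂ (fun w : ℂ => ∫ ξ in Set.Ioi (0 : ℝ),
      ((ξ ^ (s - 1) : ℝ) : ℂ) * cexp (-(w * ξ))) {w | 0 < w.re} := by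
  intro w₀ hw₀
  have hw₀' : 0 < w₀.re := hw₀
  refine DifferentiableAt.differentiableWithinAt ?_
  have hU : {w : ℂ | w₀.re / 2 < w.re} ∈ 𝓝 w₀ :=
    (isOpen_lt continuous_const Complex.continuous_re).mem_nhds (by simpa using hw₀')
  refine (hasDerivAt_integral_of_dominated_loc_of_deriv_le (μ := volume.restrict (Set.Ioi 0))
    (F := fun w ξ => ((ξ ^ (s - 1) : ℝ) : ℂ) * cexp (-(w * ξ))) (s := {w : ℂ | w₀.re / 2 < w.re})
    (bound := fun ξ : ℝ => ξ ^ (s + 1 - 1) * Real.exp (-(w₀.re / 2 * ξ)))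
    (F' := fun w ξ => -(((ξ ^ (s + 1 - 1) : ℝ) : ℂ) * cexp (-(w * ξ)))) hU ?_
    (integrableOn_rpow_mul_cexp hs hw₀) ?_ ?_ ?_ ?_).2.differentiableAt
  · exact Eventually.of_forall fun w => aestronglyMeasurable_rpow_mul_cexp _ _
  · exact (aestronglyMeasurable_rpow_mul_cexp _ _).neg
  · filter_upwards [ae_restrict_mem measurableSet_Ioi] with ξ hξ w hw
    have hξ' : 0 < ξ := hξ
    have hw' : w₀.re / 2 < w.re := hw
    rw [norm_neg, norm_rpow_mul_cexp hξ'.le]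
    gcongr
  · exact integrableOn_rpow_mul_exp_neg_mul (by linarith) (by linarith)
  · filter_upwards [ae_restrict_mem measurableSet_Ioi] with ξ hξ w _
    have hξ' : 0 < ξ := hξ
    have h1 : HasDerivAt (fun w : ℂ => -(w * ξ)) (-(1 * (ξ : ℂ))) w :=
      ((hasDerivAt_id w).mul_const (ξ : ℂ)).neg
    convert! (h1.cexp).const_mul ((ξ ^ (s - 1) : ℝ) : ℂ) using 1
    have h2 : ξ ^ (s + 1 - 1) = ξ ^ (s - 1) * ξ := by
      rw [← Real.rpow_add_one hξ'.ne']
      congr 1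
      ring
    rw [h2]
    push_cast
    ring

/-- The Gamma integral with a complex rate, obtained from the real one by analytic continuation. -/
theorem integral_rpow_mul_cexp {s : ℝ} (hs : 0 < s) {w : ℂ} (hw : 0 < w.re) :
    ∫ ξ in Set.Ioi (0 : ℝ), ((ξ ^ (s - 1) : ℝ) : ℂ) * cexp (-(w * ξ)) =
      (Real.Gamma s : ℂ) * w ^ (-(s : ℂ)) := by
  have hF := (differentiableOn_integral_rpow_mul_cexp hs).analyticOnNhd isOpen_rightHalfPlane
  have hG : AnalyticOnNhd ℂ (fun w : ℂ => (Real.Gamma s : ℂ) * w ^ (-(s : ℂ))) {w | 0 < w.re} := by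
    refine DifferentiableOn.analyticOnNhd (fun w hw => ?_) isOpen_rightHalfPlane
    exact (((hasDerivAt_id w).cpow_const (Or.inl hw)).const_mul _).differentiableAt
      |>.differentiableWithinAt
  have hconn : IsPreconnected {w : ℂ | 0 < w.re} :=
    (convex_halfSpace_re_gt 0).isPreconnected
  have h1 : (1 : ℂ) ∈ {w : ℂ | 0 < w.re} := by simp
  refine hF.eqOn_of_preconnected_of_frequently_eq hG hconn h1 ?_ hw
  -- the two sides agree on the positive real axis
  have hreal : ∀ r : ℝ, 0 < r → ∫ ξ in Set.Ioi (0 : ℝ),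
      ((ξ ^ (s - 1) : ℝ) : ℂ) * cexp (-((r : ℂ) * ξ)) =
      (Real.Gamma s : ℂ) * (r : ℂ) ^ (-(s : ℂ)) := by
    intro r hr
    have h2 := Real.integral_rpow_mul_exp_neg_mul_Ioi hs hr
    have h3 : ∀ ξ : ℝ, ((ξ ^ (s - 1) : ℝ) : ℂ) * cexp (-((r : ℂ) * ξ)) =
        ((ξ ^ (s - 1) * Real.exp (-(r * ξ)) : ℝ) : ℂ) := fun ξ => by push_cast; rfl
    simp_rw [h3]
    rw [integral_complex_ofReal, h2, one_div, Real.inv_rpow hr.le, ← Real.rpow_neg hr.le]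
    push_cast [Complex.ofReal_cpow hr.le]
    ring
  have hseq : Tendsto (fun n : ℕ => ((1 + 1 / ((n : ℝ) + 1) : ℝ) : ℂ)) atTop (𝓝[≠] 1) := by
    rw [tendsto_nhdsWithin_iff]
    constructor
    · have h4 : Tendsto (fun n : ℕ => 1 + 1 / ((n : ℝ) + 1)) atTop (𝓝 (1 + 0)) :=
        tendsto_const_nhds.add tendsto_one_div_add_atTop_nhds_zero_nat
      rw [add_zero] at h4
      exact (Complex.continuous_ofReal.tendsto' 1 1 (by simp)).comp h4
    · refine Eventually.of_forall fun n h5 => ?_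
      have h6 : 1 + 1 / ((n : ℝ) + 1) = 1 :=
        Complex.ofReal_injective (Eq.trans h5 Complex.ofReal_one.symm)
      have h7 : 0 < 1 / ((n : ℝ) + 1) := by positivity
      linarith
  exact hseq.frequently (Frequently.of_forall fun n => hreal _ (by positivity))

theorem ofReal_mul_cpow {r : ℝ} (hr : 0 < r) {x : ℂ} (hx : x ≠ 0) (p : ℂ) :
    ((r : ℂ) * x) ^ p = (r : ℂ) ^ p * x ^ p := by
  have hr' : (r : ℂ) ≠ 0 := by exact_mod_cast hr.ne'
  rw [cpow_def_of_ne_zero (mul_ne_zero hr' hx), cpow_def_of_ne_zero hr', cpow_def_of_ne_zero hx,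
    Complex.log_ofReal_mul hr hx, add_mul, Complex.exp_add, Complex.ofReal_log hr.le]

/-- The function `Γ(s) (-i (z - t)) ^ (-s) = ∫ ξ ^ (s - 1) exp (i ξ (z - t)) dξ` of `t`, holomorphic
in the parameter `z` of the upper half-plane. -/
def powerKernel (s : ℝ) (z : ℂ) (t : ℝ) : ℂ :=
  (Real.Gamma s : ℂ) * (-I * (z - t)) ^ (-(s : ℂ))

theorem re_neg_I_mul (z : ℂ) (t : ℝ) : (-I * (z - t)).re = z.im := by simp

theorem neg_I_mul_mem_slitPlane {z : ℂ} (hz : z ∈ halfPlane) (t : ℝ) :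
    -I * (z - t) ∈ slitPlane := Or.inl (by rw [re_neg_I_mul]; exact hz)

theorem conj_powerKernel {s : ℝ} {z : ℂ} (hz : z ∈ halfPlane) (t : ℝ) :
    conj (powerKernel s z t) = (Real.Gamma s : ℂ) * (conj (-I * (z - t))) ^ (-(s : ℂ)) := by
  rw [powerKernel, map_mul, Complex.conj_ofReal,
    Complex.conj_cpow _ _ (mem_slitPlane_iff_arg.1 (neg_I_mul_mem_slitPlane hz t)).1]
  simp

theorem cauchyWavelet_eq {α : ℝ} (hα : -1 < α) (t : ℝ) :
    cauchyWavelet α t =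
      (Real.Gamma ((α + 1) / 2) : ℂ) * (1 - I * t) ^ (-(((α + 1) / 2 : ℝ) : ℂ)) := by
  have h1 : ∀ ξ : ℝ, (cauchyWaveletHat α ξ : ℂ) * cexp (I * ξ * t) =
      (Set.Ici (0 : ℝ)).indicator (fun ξ : ℝ => ((ξ ^ ((α + 1) / 2 - 1) : ℝ) : ℂ) *
        cexp (-((1 - I * t) * ξ))) ξ := by
    intro ξ
    by_cases hξ : 0 ≤ ξ
    · rw [Set.indicator_of_mem (by exact hξ), cauchyWaveletHat, if_pos hξ]
      have h2 : (α - 1) / 2 = (α + 1) / 2 - 1 := by ring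
      rw [h2]
      push_cast
      rw [mul_assoc, ← Complex.exp_add]
      congr 2
      ring
    · rw [Set.indicator_of_notMem (by exact hξ), cauchyWaveletHat, if_neg hξ]
      simp
  rw [cauchyWavelet]
  simp_rw [h1]
  rw [integral_indicator measurableSet_Ici, integral_Ici_eq_integral_Ioi,
    integral_rpow_mul_cexp (by linarith) (by simp)]

/-- The analyzing wavelets are, up to a power of `y`, conjugates of functions that depend
holomorphically on `z`. -/
theorem waveletAtom_eq {α : ℝ} (hα : -1 < α) {z : ℂ} (hz : z ∈ halfPlane) (t : ℝ) :
    waveletAtom α z t = ((z.im ^ (α / 2) : ℝ) : ℂ) * conj (powerKernel ((α + 1) / 2) z t) := by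
  have hy : 0 < z.im := hz
  have hne : conj (-I * (z - t)) ≠ 0 := by
    rw [Ne, map_eq_zero]
    exact slitPlane_ne_zero (neg_I_mul_mem_slitPlane hz t)
  rw [waveletAtom, translate, dilate, cauchyWavelet_eq hα, conj_powerKernel hz]
  have h1 : (1 - I * (((t - z.re) / z.im : ℝ) : ℂ)) =
      ((z.im⁻¹ : ℝ) : ℂ) * conj (-I * (z - t)) := by
    have hy' : (z.im : ℂ) ≠ 0 := by exact_mod_cast hy.ne'
    apply Complex.ext
    · simp [hy.ne']
    · simp
      ring
  rw [h1, ofReal_mul_cpow (by positivity) hne, ← Complex.ofReal_neg,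
    ← Complex.ofReal_cpow (by positivity)]
  have h2 : z.im ^ (α / 2) = z.im ^ (-(1 / 2) : ℝ) * (z.im⁻¹) ^ (-((α + 1) / 2)) := by
    rw [Real.inv_rpow hy.le, ← Real.rpow_neg hy.le, ← Real.rpow_add hy]
    congr 1
    ring
  rw [h2]
  push_cast
  ring

/-! ### Decay and regularity of the kernels -/

theorem norm_powerKernel {s : ℝ} (hs : 0 < s) (z : ℂ) (t : ℝ) :
    ‖powerKernel s z t‖ = Real.Gamma s * ‖z - t‖ ^ (-s) := by
  rw [powerKernel, norm_mul, Complex.norm_real, Real.norm_of_nonneg (Real.Gamma_pos_of_pos hs).le,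
    ← Complex.ofReal_neg, Complex.norm_cpow_real]
  simp

theorem exists_le_norm_sub_ofReal {c : ℂ} (hc : c ∈ halfPlane) :
    ∃ δ : ℝ, 0 < δ ∧ ∀ z ∈ Metric.closedBall c (c.im / 2), ∀ t : ℝ, δ * (1 + |t|) ≤ ‖z - t‖ := by
  have hy : 0 < c.im := hc
  set y := c.im / 2 with hydef
  have hy0 : 0 < y := by positivity
  set M := ‖c‖ + y with hM
  have hM0 : 0 ≤ M := by positivity
  refine ⟨y / (1 + M + y), by positivity, fun z hz t => ?_⟩
  have hz' : ‖z - c‖ ≤ y := by simpa [dist_eq_norm] using hz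
  have h1 : y ≤ ‖z - t‖ := by
    have h2 := (Complex.abs_im_le_norm (z - c)).trans hz'
    have h3 := Complex.abs_im_le_norm (z - t)
    simp only [sub_im, ofReal_im, sub_zero] at h2 h3
    have := (abs_le.1 h2).1
    have := le_abs_self z.im
    have : c.im = 2 * y := by rw [hydef]; ring
    linarith
  have h2 : |t| - M ≤ ‖z - t‖ := by
    have h3 : ‖z‖ ≤ M := by
      have := norm_add_le (z - c) c
      rw [sub_add_cancel] at this
      linarith
    have h4 := norm_sub_norm_le (t : ℂ) z
    rw [norm_sub_rev, Complex.norm_real, Real.norm_eq_abs] at h4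
    linarith
  rw [div_mul_eq_mul_div, div_le_iff₀ (by positivity)]
  nlinarith

theorem norm_powerKernel_le {s : ℝ} (hs : 0 < s) {z : ℂ} {t δ : ℝ} (hδ : 0 < δ)
    (h : δ * (1 + |t|) ≤ ‖z - t‖) :
    ‖powerKernel s z t‖ ≤ Real.Gamma s * δ ^ (-s) * (1 + |t|) ^ (-s) := by
  rw [norm_powerKernel hs, mul_assoc, ← Real.mul_rpow hδ.le (by positivity)]
  refine mul_le_mul_of_nonneg_left ?_ (Real.Gamma_pos_of_pos hs).le
  exact Real.rpow_le_rpow_of_nonpos (by positivity) h (by linarith)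

theorem hasDerivAt_powerKernel {s : ℝ} (hs : 0 < s) {z : ℂ} (hz : z ∈ halfPlane) (t : ℝ) :
    HasDerivAt (fun z => powerKernel s z t) (I * powerKernel (s + 1) z t) z := by
  have h1 : HasDerivAt (fun z : ℂ => -I * (z - t)) (-I * 1) z :=
    ((hasDerivAt_id z).sub_const _).const_mul _
  convert! (h1.cpow_const (c := -(s : ℂ)) (neg_I_mul_mem_slitPlane hz t)).const_mul
    (Real.Gamma s : ℂ) using 1
  rw [powerKernel, Real.Gamma_add_one hs.ne']
  have h2 : -((s + 1 : ℝ) : ℂ) = -(s : ℂ) - 1 := by push_cast; ring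
  rw [h2]
  push_cast
  ring

theorem hasDerivAt_powerKernel_time {s : ℝ} (hs : 0 < s) {z : ℂ} (hz : z ∈ halfPlane) (t : ℝ) :
    HasDerivAt (fun t => powerKernel s z t) (-(I * powerKernel (s + 1) z t)) t := by
  have h1 : HasDerivAt (fun t : ℝ => z - (t : ℂ)) (-1) t := by
    simpa using (Complex.ofRealCLM.hasDerivAt (x := t)).const_sub z
  have h0 : z - (t : ℂ) ∈ halfPlane := by simpa [halfPlane] using hz
  have h2 : HasDerivAt (fun w => powerKernel s w 0) (I * powerKernel (s + 1) (z - t) 0)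
    (z - (t : ℂ)) := hasDerivAt_powerKernel hs h0 0
  have h3 : ∀ (s t : ℝ), powerKernel s z t = powerKernel s (z - (t : ℂ)) 0 := fun s t => by
    simp [powerKernel]
  have h4 := h2.scomp t h1
  rw [h3 (s + 1) t]
  simp_rw [h3 s]
  simpa [Function.comp_def] using h4

theorem continuous_powerKernel {s : ℝ} (hs : 0 < s) {z : ℂ} (hz : z ∈ halfPlane) :
    Continuous (powerKernel s z) :=
  continuous_iff_continuousAt.2 fun t => (hasDerivAt_powerKernel_time hs hz t).continuousAt

/-- The integral `∫ (1 + |t|) ^ (-2 s) dt`. -/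
def decayIntegral (s : ℝ) : ℝ := ∫ t : ℝ, (1 + |t|) ^ (-(2 * s))

theorem integrable_decay {r : ℝ} (hr : 1 < r) : Integrable fun t : ℝ => (1 + |t|) ^ (-r) := by
  simpa using integrable_one_add_norm (E := ℝ) (μ := volume) (r := r) (by simpa using hr)

theorem memLp_of_decay {s C : ℝ} (hs : 1 / 2 < s) {g : ℝ → ℂ}
    (hg : AEStronglyMeasurable g volume) (h : ∀ᵐ t, ‖g t‖ ≤ C * (1 + |t|) ^ (-s)) :
    MemLp g 2 volume ∧ ∫ t, ‖g t‖ ^ 2 ≤ C ^ 2 * decayIntegral s := by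
  have hb : ∀ᵐ t, ‖g t‖ ^ 2 ≤ C ^ 2 * (1 + |t|) ^ (-(2 * s)) := by
    filter_upwards [h] with t ht
    have h1 : (1 + |t|) ^ (-(2 * s)) = ((1 + |t|) ^ (-s)) ^ 2 := by
      rw [← Real.rpow_natCast, ← Real.rpow_mul (by positivity)]
      congr 1
      push_cast
      ring
    rw [h1, ← mul_pow]
    gcongr
  have hi : Integrable fun t : ℝ => C ^ 2 * (1 + |t|) ^ (-(2 * s)) :=
    (integrable_decay (by linarith)).const_mul _
  constructor
  · refine (memLp_two_iff_integrable_sq_norm hg).2 (hi.mono' (hg.norm.pow 2) ?_)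
    filter_upwards [hb] with t ht
    rwa [Real.norm_of_nonneg (by positivity)]
  · rw [decayIntegral, ← integral_const_mul]
    exact integral_mono_of_nonneg (ae_of_all _ fun t => by positivity) hi hb

theorem memLp_powerKernel {s : ℝ} (hs : 1 / 2 < s) {z : ℂ} (hz : z ∈ halfPlane) :
    MemLp (powerKernel s z) 2 volume := by
  obtain ⟨δ, hδ, h⟩ := exists_le_norm_sub_ofReal hz
  have hy : 0 < z.im := hz
  refine (memLp_of_decay hs (continuous_powerKernel (by linarith) hz).aestronglyMeasurable
    (ae_of_all _ fun t => norm_powerKernel_le (by linarith) hδ (h z ?_ t))).1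
  exact Metric.mem_closedBall_self (by positivity)

theorem memLp_conj_powerKernel {s : ℝ} (hs : 1 / 2 < s) {z : ℂ} (hz : z ∈ halfPlane) :
    MemLp (fun t => conj (powerKernel s z t)) 2 volume := (memLp_powerKernel hs hz).star

theorem closedBall_subset_halfPlane {c : ℂ} (hc : c ∈ halfPlane) :
    Metric.closedBall c (c.im / 2) ⊆ halfPlane := by
  intro z hz
  have hy : 0 < c.im := hc
  have hz' : ‖z - c‖ ≤ c.im / 2 := by simpa [dist_eq_norm] using hz
  have h2 := (abs_le.1 ((Complex.abs_im_le_norm (z - c)).trans hz')).1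
  simp only [sub_im] at h2
  show 0 < z.im
  linarith

/-- The coefficients of the kernels, conjugated, are holomorphic in `z`. -/
theorem differentiableOn_conj_coeff (e : L2Basis) {s : ℝ} (hs : 1 / 2 < s) (n : ℕ) :
    DifferentiableOn ℂ (fun z => conj (coeff e (fun t => conj (powerKernel s z t)) n))
      halfPlane := by
  have hrw : ∀ z, conj (coeff e (fun t => conj (powerKernel s z t)) n) =
      ∫ t, powerKernel s z t * (e n : ℝ → ℂ) t := by
    intro z
    rw [coeff, ← integral_conj]
    simp
  simp_rw [hrw]
  intro c hc
  have hy : 0 < c.im := hc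
  obtain ⟨δ, hδ, h⟩ := exists_le_norm_sub_ofReal hc
  have he : MemLp (e n : ℝ → ℂ) 2 volume := Lp.memLp (e n)
  refine DifferentiableAt.differentiableWithinAt ?_
  refine (hasDerivAt_integral_of_dominated_loc_of_deriv_le
    (s := Metric.closedBall c (c.im / 2))
    (bound := fun t : ℝ => Real.Gamma (s + 1) * δ ^ (-(s + 1)) * (1 + |t|) ^ (-(s + 1)) *
      ‖(e n : ℝ → ℂ) t‖)
    (F' := fun z t => I * powerKernel (s + 1) z t * (e n : ℝ → ℂ) t)
    (Metric.closedBall_mem_nhds c (by positivity)) ?_ ?_ ?_ ?_ ?_ ?_).2.differentiableAt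
  · filter_upwards [Metric.closedBall_mem_nhds c (show 0 < c.im / 2 by positivity)] with z hz
    exact (continuous_powerKernel (by linarith)
      (closedBall_subset_halfPlane hc hz)).aestronglyMeasurable.mul he.1
  · exact (memLp_powerKernel hs hc).integrable_mul he
  · exact ((continuous_powerKernel (by linarith) hc).aestronglyMeasurable.const_mul I).mul he.1
  · refine ae_of_all _ fun t z hz => ?_
    rw [norm_mul, norm_mul, norm_I, one_mul]
    gcongr
    exact norm_powerKernel_le (by linarith) hδ (h z hz t)
  · have h1 : MemLp (fun t : ℝ => Real.Gamma (s + 1) * δ ^ (-(s + 1)) * (1 + |t|) ^ (-(s + 1))) 2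
        volume := by
      have hm : AEStronglyMeasurable
          (fun t : ℝ => Real.Gamma (s + 1) * δ ^ (-(s + 1)) * (1 + |t|) ^ (-(s + 1))) volume :=
        Measurable.aestronglyMeasurable (by fun_prop)
      refine (memLp_two_iff_integrable_sq hm).2 ?_
      have h2 : ∀ t : ℝ, (Real.Gamma (s + 1) * δ ^ (-(s + 1)) * (1 + |t|) ^ (-(s + 1))) ^ 2 =
          (Real.Gamma (s + 1) * δ ^ (-(s + 1))) ^ 2 * (1 + |t|) ^ (-(2 * (s + 1))) := by
        intro t
        rw [mul_pow, ← Real.rpow_natCast ((1 + |t|) ^ (-(s + 1))), ← Real.rpow_mul (by positivity)]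
        congr 2
        push_cast
        ring
      simp_rw [h2]
      exact (integrable_decay (by linarith)).const_mul _
    exact h1.integrable_mul he.norm
  · refine ae_of_all _ fun t z hz => ?_
    exact (hasDerivAt_powerKernel (by linarith) (closedBall_subset_halfPlane hc hz) t).mul_const _

/-! ### The sampling error -/

/-- The indicator function of the `ℓ`-th sampling interval. -/
def sampleCell (T : ℝ) (ℓ : ℤ) : ℝ → ℂ :=
  (Set.Ioo (((ℓ : ℝ) - 1) * T) ((ℓ : ℝ) * T)).indicator (fun _ => (1 : ℂ))

/-- The step function taking the value `g (ℓ T)` on the `ℓ`-th of the `2 L` sampling intervals. -/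
def sampledStep (L : ℕ) (T : ℝ) (g : ℝ → ℂ) (t : ℝ) : ℂ :=
  ∑ ℓ ∈ Finset.Icc (-(L : ℤ) + 1) (L : ℤ), g ((ℓ : ℝ) * T) * sampleCell T ℓ t

theorem memLp_sampleCell (T : ℝ) (ℓ : ℤ) : MemLp (sampleCell T ℓ) 2 volume :=
  memLp_indicator_const 2 measurableSet_Ioo 1 (Or.inr (by simp))

theorem memLp_sampledStep (L : ℕ) (T : ℝ) (g : ℝ → ℂ) : MemLp (sampledStep L T g) 2 volume :=
  memLp_finsetSum _ fun ℓ _ => (memLp_sampleCell T ℓ).const_mul _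

theorem coeff_sampledStep (e : L2Basis) (L : ℕ) (T : ℝ) (g : ℝ → ℂ) (n : ℕ) :
    coeff e (sampledStep L T g) n = ∑ ℓ ∈ Finset.Icc (-(L : ℤ) + 1) (L : ℤ),
      g ((ℓ : ℝ) * T) * coeff e (sampleCell T ℓ) n :=
  coeff_sum e _ (fun ℓ : ℤ => g ((ℓ : ℝ) * T)) (fun ℓ _ => memLp_sampleCell T ℓ) n

theorem sampledStep_of_mem {L : ℕ} {T : ℝ} (hT : 0 < T) (g : ℝ → ℂ) {t : ℝ} {k : ℤ}
    (hk : k ∈ Finset.Icc (-(L : ℤ) + 1) (L : ℤ))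
    (ht : t ∈ Set.Ioo (((k : ℝ) - 1) * T) ((k : ℝ) * T)) :
    sampledStep L T g t = g ((k : ℝ) * T) := by
  rw [sampledStep, Finset.sum_eq_single k]
  · simp [sampleCell, Set.indicator_of_mem ht]
  · intro ℓ _ hne
    rw [sampleCell, Set.indicator_of_notMem, mul_zero]
    rintro ⟨h1, h2⟩
    apply hne
    have h3 := lt_of_mul_lt_mul_right (h1.trans ht.2) hT.le
    have h4 := lt_of_mul_lt_mul_right (ht.1.trans h2) hT.le
    have h5 : ℓ - 1 < k := by exact_mod_cast h3
    have h6 : k - 1 < ℓ := by exact_mod_cast h4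
    omega
  · exact fun h => absurd hk h

theorem sampledStep_of_le_abs {L : ℕ} {T : ℝ} (hT : 0 < T) (g : ℝ → ℂ) {t : ℝ}
    (ht : L * T ≤ |t|) : sampledStep L T g t = 0 := by
  refine Finset.sum_eq_zero fun ℓ hℓ => ?_
  rw [sampleCell, Set.indicator_of_notMem, mul_zero]
  rintro ⟨h1, h2⟩
  obtain ⟨h3, h4⟩ := Finset.mem_Icc.1 hℓ
  have h3' : -(L : ℝ) ≤ (ℓ : ℝ) - 1 := by
    have : -(L : ℤ) ≤ ℓ - 1 := by omega
    exact_mod_cast this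
  have h4' : (ℓ : ℝ) ≤ L := by exact_mod_cast h4
  have : |t| < L * T := abs_lt.2 ⟨by nlinarith, by nlinarith⟩
  linarith

theorem exists_sampleCell {L : ℕ} {T : ℝ} (hT : 0 < T) {t : ℝ} (ht : |t| < L * T)
    (hne : ∀ ℓ : ℤ, t ≠ (ℓ : ℝ) * T) :
    ∃ k ∈ Finset.Icc (-(L : ℤ) + 1) (L : ℤ), t ∈ Set.Ioo (((k : ℝ) - 1) * T) ((k : ℝ) * T) := by
  obtain ⟨h1, h2⟩ := abs_lt.1 ht
  have h3 : t / T < L := (div_lt_iff₀ hT).2 h2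
  have h4 : -(L : ℝ) < t / T := (lt_div_iff₀ hT).2 (by linarith)
  refine ⟨⌈t / T⌉, Finset.mem_Icc.2 ⟨?_, ?_⟩, ?_, ?_⟩
  · have : -(L : ℤ) < ⌈t / T⌉ := Int.lt_ceil.2 (by push_cast; exact h4)
    omega
  · exact Int.ceil_le.2 (by push_cast; exact h3.le)
  · rw [← lt_div_iff₀ hT]
    linarith [Int.ceil_lt_add_one (t / T)]
  · exact lt_of_le_of_ne ((div_le_iff₀ hT).1 (Int.le_ceil _)) (hne _)

/-- Pointwise bound of the sampling error: inside the window by the mean value theorem, outside by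
the decay of `g`, part of which (the exponent `γ`) is spent on the length of the window. -/
theorem norm_sampledStep_sub_le {L : ℕ} {T s γ A A' : ℝ} (hT : 0 < T) (hT1 : T ≤ 1) (hL : 1 ≤ L)
    (hs : 0 ≤ s) (hγ : 0 ≤ γ) {g g' : ℝ → ℂ} (hg : ∀ t, ‖g t‖ ≤ A * (1 + |t|) ^ (-s))
    (hd : ∀ t, HasDerivAt g (g' t) t) (hg' : ∀ t, ‖g' t‖ ≤ A' * (1 + |t|) ^ (-s)) :
    ∀ᵐ t : ℝ, ‖sampledStep L T g t - g t‖ ≤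
      (2 ^ s * A' * T + A * (L * T) ^ (-γ)) * (1 + |t|) ^ (-(s - γ)) := by
  have hA : 0 ≤ A := by simpa using (norm_nonneg _).trans (hg 0)
  have hA' : 0 ≤ A' := by simpa using (norm_nonneg _).trans (hg' 0)
  have hLT : 0 < L * T := by
    have : (0 : ℝ) < L := by exact_mod_cast hL
    positivity
  have hnull : ∀ᵐ t : ℝ, ∀ ℓ : ℤ, t ≠ (ℓ : ℝ) * T :=
    ae_all_iff.2 fun ℓ => Measure.ae_ne volume _
  filter_upwards [hnull] with t ht
  have h1t : (1 : ℝ) ≤ 1 + |t| := by linarith [abs_nonneg t]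
  rcases lt_or_ge |t| (L * T) with hin | hout
  · obtain ⟨k, hk, htk⟩ := exists_sampleCell hT hin ht
    rw [sampledStep_of_mem hT g hk htk]
    have hb : ∀ u ∈ Set.Icc t ((k : ℝ) * T), ‖g' u‖ ≤ 2 ^ s * A' * (1 + |t|) ^ (-s) := by
      intro u hu
      have h1 : |t| ≤ |u| + 1 := by
        have h2 : |t - u| ≤ 1 := by
          rw [abs_le]
          constructor <;> nlinarith [hu.1, hu.2, htk.1, htk.2]
        have := abs_sub_abs_le_abs_sub t u
        linarith
      have h3 : (1 + |t|) / 2 ≤ 1 + |u| := by linarith [abs_nonneg u]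
      calc ‖g' u‖ ≤ A' * (1 + |u|) ^ (-s) := hg' u
        _ ≤ A' * ((1 + |t|) / 2) ^ (-s) := by
            refine mul_le_mul_of_nonneg_left ?_ hA'
            exact Real.rpow_le_rpow_of_nonpos (by positivity) h3 (by linarith)
        _ = 2 ^ s * A' * (1 + |t|) ^ (-s) := by
            rw [Real.div_rpow (by positivity) (by norm_num), Real.rpow_neg (by norm_num : (0:ℝ) ≤ 2)]
            field_simp
    have hmv := (convex_Icc t ((k : ℝ) * T)).norm_image_sub_le_of_norm_hasDerivWithin_le
      (fun u _ => (hd u).hasDerivWithinAt) hb (Set.left_mem_Icc.2 htk.2.le)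
      (Set.right_mem_Icc.2 htk.2.le)
    have hlen : ‖(k : ℝ) * T - t‖ ≤ T := by
      rw [Real.norm_of_nonneg (by linarith [htk.2])]
      linarith [htk.1]
    calc ‖g ((k : ℝ) * T) - g t‖ ≤ 2 ^ s * A' * (1 + |t|) ^ (-s) * T :=
          hmv.trans (mul_le_mul_of_nonneg_left hlen (by positivity))
      _ ≤ 2 ^ s * A' * (1 + |t|) ^ (-(s - γ)) * T := by
          gcongr ?_ * T
          refine mul_le_mul_of_nonneg_left ?_ (by positivity)
          exact Real.rpow_le_rpow_of_exponent_le h1t (by linarith)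
      _ ≤ _ := by
          have : 0 ≤ A * (L * T) ^ (-γ) * (1 + |t|) ^ (-(s - γ)) := by positivity
          linarith
  · rw [sampledStep_of_le_abs hT g hout, zero_sub, norm_neg]
    have hsplit : (1 + |t|) ^ (-s) = (1 + |t|) ^ (-γ) * (1 + |t|) ^ (-(s - γ)) := by
      rw [← Real.rpow_add (by positivity)]
      congr 1
      ring
    calc ‖g t‖ ≤ A * ((1 + |t|) ^ (-γ) * (1 + |t|) ^ (-(s - γ))) := hsplit ▸ hg t
      _ ≤ A * ((L * T) ^ (-γ) * (1 + |t|) ^ (-(s - γ))) := by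
          refine mul_le_mul_of_nonneg_left (mul_le_mul_of_nonneg_right ?_ (by positivity)) hA
          exact Real.rpow_le_rpow_of_nonpos hLT (by linarith) (by linarith)
      _ ≤ _ := by
          have : 0 ≤ 2 ^ s * A' * T * (1 + |t|) ^ (-(s - γ)) := by positivity
          linarith

/-- Half the exponent of decay, in the number of samples, of the bound for the mean square error. -/
def errorExponent (α : ℝ) : ℝ := 3 * α / (4 * (α + 2))

theorem samplingInterval_pos (α : ℝ) {L : ℕ} (hL : 1 ≤ L) : 0 < samplingInterval α L := by
  have : (0 : ℝ) < L := by exact_mod_cast hL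
  exact Real.rpow_pos_of_pos this _

theorem samplingInterval_le_rpow {α : ℝ} (hα : 0 < α) {L : ℕ} (hL : 1 ≤ L) :
    samplingInterval α L ≤ (L : ℝ) ^ (-errorExponent α) := by
  refine Real.rpow_le_rpow_of_exponent_le (by exact_mod_cast hL) ?_
  rw [errorExponent, neg_le_neg_iff, div_le_div_iff₀ (by positivity) (by positivity)]
  nlinarith

theorem window_rpow_eq {α : ℝ} (hα : 0 < α) {L : ℕ} (hL : 1 ≤ L) :
    (L * samplingInterval α L) ^ (-(3 * α / 8)) = (L : ℝ) ^ (-errorExponent α) := by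
  have hL0 : (0 : ℝ) < L := by exact_mod_cast hL
  have h1 : (L : ℝ) * samplingInterval α L = (L : ℝ) ^ (2 / (α + 2)) := by
    rw [samplingInterval, ← Real.rpow_one_add' hL0.le]
    · congr 1
      field_simp
      ring
    · have : 1 + -(α / (α + 2)) = 2 / (α + 2) := by field_simp; ring
      rw [this]
      positivity
  rw [h1, ← Real.rpow_mul hL0.le, errorExponent]
  congr 1
  field_simp
  ring

theorem samplingInterval_le_one {α : ℝ} (hα : 0 < α) {L : ℕ} (hL : 1 ≤ L) :
    samplingInterval α L ≤ 1 :=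
  Real.rpow_le_one_of_one_le_of_nonpos (by exact_mod_cast hL)
    (neg_nonpos.2 (by positivity))

/-- The difference between the sampled and the exact (normalized) analyzing wavelet. -/
def samplingError (α : ℝ) (L : ℕ) (z : ℂ) (t : ℝ) : ℂ :=
  sampledStep L (samplingInterval α L) (fun t => conj (powerKernel ((α + 1) / 2) z t)) t -
    conj (powerKernel ((α + 1) / 2) z t)

theorem memLp_samplingError {α : ℝ} (hα : 0 < α) (L : ℕ) {z : ℂ} (hz : z ∈ halfPlane) :
    MemLp (samplingError α L z) 2 volume :=
  (memLp_sampledStep _ _ _).sub (memLp_conj_powerKernel (by linarith) hz)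

theorem coeff_samplingError (e : L2Basis) {α : ℝ} (hα : 0 < α) (L : ℕ) {z : ℂ}
    (hz : z ∈ halfPlane) (n : ℕ) :
    coeff e (samplingError α L z) n =
      ∑ ℓ ∈ Finset.Icc (-(L : ℤ) + 1) (L : ℤ),
        conj (powerKernel ((α + 1) / 2) z ((ℓ : ℝ) * samplingInterval α L)) *
          coeff e (sampleCell (samplingInterval α L) ℓ) n -
      coeff e (fun t => conj (powerKernel ((α + 1) / 2) z t)) n := by
  rw [← coeff_sampledStep e L _ (fun t => conj (powerKernel ((α + 1) / 2) z t))]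
  exact coeff_sub e (memLp_sampledStep _ _ _) (memLp_conj_powerKernel (by linarith) hz) n

theorem differentiableOn_conj_coeff_samplingError (e : L2Basis) {α : ℝ} (hα : 0 < α) (L n : ℕ) :
    DifferentiableOn ℂ (fun z => conj (coeff e (samplingError α L z) n)) halfPlane := by
  have h1 : DifferentiableOn ℂ (fun z => ∑ ℓ ∈ Finset.Icc (-(L : ℤ) + 1) (L : ℤ),
      powerKernel ((α + 1) / 2) z ((ℓ : ℝ) * samplingInterval α L) *
          conj (coeff e (sampleCell (samplingInterval α L) ℓ) n) -
      conj (coeff e (fun t => conj (powerKernel ((α + 1) / 2) z t)) n)) halfPlane := by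
    refine (DifferentiableOn.fun_sum fun ℓ _ z hz => ?_).sub
      (differentiableOn_conj_coeff e (by linarith) n)
    exact ((hasDerivAt_powerKernel (by linarith) hz _).mul_const
      _).differentiableAt.differentiableWithinAt
  refine h1.congr fun z hz => ?_
  rw [coeff_samplingError e hα L hz n]
  simp [map_sum]

/-- The mean square sampling error, uniformly on a disc. -/
theorem exists_integral_samplingError_le {α : ℝ} (hα : 0 < α) {c : ℂ} (hc : c ∈ halfPlane) :
    ∃ B : ℝ, ∀ L : ℕ, 1 ≤ L → ∀ z ∈ Metric.closedBall c (c.im / 2),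
      ∫ t, ‖samplingError α L z t‖ ^ 2 ≤ B * ((L : ℝ) ^ (-errorExponent α)) ^ 2 := by
  obtain ⟨δ, hδ, hδz⟩ := exists_le_norm_sub_ofReal hc
  set β := (α + 1) / 2 with hβ
  -- spending the exponent `3 α / 8 < α / 2` keeps the remaining decay square integrable
  have hβ0 : 0 < β := by positivity
  set A := Real.Gamma β * δ ^ (-β) with hA
  set A' := Real.Gamma (β + 1) * δ ^ (-(β + 1)) with hA'
  have hA0 : 0 ≤ A := mul_nonneg (Real.Gamma_pos_of_pos hβ0).le (by positivity)
  have hA0' : 0 ≤ A' := mul_nonneg (Real.Gamma_pos_of_pos (by positivity)).le (by positivity)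
  refine ⟨(2 ^ β * A' + A) ^ 2 * decayIntegral (β - 3 * α / 8), fun L hL z hz => ?_⟩
  have hzH := closedBall_subset_halfPlane hc hz
  have hT := samplingInterval_pos α hL
  have hpt := norm_sampledStep_sub_le (L := L) (T := samplingInterval α L) (s := β)
    (γ := 3 * α / 8) (A := A) (A' := A') hT (samplingInterval_le_one hα hL) hL hβ0.le (by positivity)
    (g := fun t => conj (powerKernel β z t))
    (g' := fun t => conj (-(I * powerKernel (β + 1) z t)))
    (fun t => by
      rw [Complex.norm_conj]
      exact norm_powerKernel_le hβ0 hδ (hδz z hz t))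
    (fun t => (hasDerivAt_powerKernel_time hβ0 hzH t).star)
    (fun t => by
      rw [Complex.norm_conj, norm_neg, norm_mul, norm_I, one_mul]
      refine (norm_powerKernel_le (by positivity) hδ (hδz z hz t)).trans ?_
      refine mul_le_mul_of_nonneg_left ?_ hA0'
      exact Real.rpow_le_rpow_of_exponent_le (by linarith [abs_nonneg t]) (by linarith))
  rw [window_rpow_eq hα hL] at hpt
  have hJ : 0 ≤ decayIntegral (β - 3 * α / 8) := integral_nonneg fun t => by positivity
  refine (memLp_of_decay (by rw [hβ]; linarith) (memLp_samplingError hα L hzH).1 hpt).2.trans ?_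
  rw [mul_right_comm ((2 ^ β * A' + A) ^ 2), ← mul_pow]
  have hle := samplingInterval_le_rpow hα hL
  gcongr ?_ ^ 2 * _
  calc 2 ^ β * A' * samplingInterval α L + A * (L : ℝ) ^ (-errorExponent α)
      ≤ 2 ^ β * A' * (L : ℝ) ^ (-errorExponent α) + A * (L : ℝ) ^ (-errorExponent α) := by gcongr
    _ = _ := by ring

theorem summable_error {α : ℝ} (hα : 1 < α) (B : ℝ) :
    Summable fun L : ℕ => (B * (((L + 1 : ℕ) : ℝ) ^ (-errorExponent α)) ^ 2) ^ 2 := by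
  have h1 : 1 < 4 * errorExponent α := by
    have h2 : 4 * errorExponent α = 3 * α / (α + 2) := by
      rw [errorExponent]
      field_simp
    rw [h2, lt_div_iff₀ (by linarith)]
    linarith
  have h3 : Summable fun L : ℕ => B ^ 2 * (((L + 1 : ℕ) : ℝ) ^ (-(4 * errorExponent α))) :=
    ((summable_nat_add_iff 1).2 (Real.summable_nat_rpow.2 (by linarith))).mul_left _
  refine h3.congr fun L => ?_
  rw [mul_pow, ← pow_mul, ← Real.rpow_natCast _ (2 * 2), ← Real.rpow_mul (by positivity)]
  congr 2
  push_cast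
  ring

/-! ### Almost sure convergence of the random series and of the discretized transform -/

theorem coeff_waveletAtom (e : L2Basis) {α : ℝ} (hα : -1 < α) {z : ℂ} (hz : z ∈ halfPlane) (n : ℕ) :
    coeff e (waveletAtom α z) n = ((z.im ^ (α / 2) : ℝ) : ℂ) *
      coeff e (fun t => conj (powerKernel ((α + 1) / 2) z t)) n := by
  rw [← coeff_const_mul]
  congr 1
  funext t
  exact waveletAtom_eq hα hz t

theorem memLp_waveletAtom {α : ℝ} (hα : 0 < α) {z : ℂ} (hz : z ∈ halfPlane) :
    MemLp (waveletAtom α z) 2 volume := by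
  have h := (memLp_conj_powerKernel (s := (α + 1) / 2) (by linarith) hz).const_mul
    ((z.im ^ (α / 2) : ℝ) : ℂ)
  convert! h using 1
  funext t
  exact waveletAtom_eq (by linarith) hz t

theorem exists_integral_powerKernel_le {s : ℝ} (hs : 1 / 2 < s) {c : ℂ} (hc : c ∈ halfPlane) :
    ∃ B : ℝ, ∀ z ∈ Metric.closedBall c (c.im / 2), ∫ t, ‖conj (powerKernel s z t)‖ ^ 2 ≤ B := by
  obtain ⟨δ, hδ, hδz⟩ := exists_le_norm_sub_ofReal hc
  refine ⟨(Real.Gamma s * δ ^ (-s)) ^ 2 * decayIntegral s, fun z hz =>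
    (memLp_of_decay hs (memLp_conj_powerKernel hs
      (closedBall_subset_halfPlane hc hz)).1 (ae_of_all _ fun t => ?_)).2⟩
  rw [Complex.norm_conj]
  exact norm_powerKernel_le (by linarith) hδ (hδz z hz t)

theorem exists_im_rpow_le {α : ℝ} (hα : 0 < α) {c : ℂ} (hc : c ∈ halfPlane) :
    ∃ C : ℝ, 0 < C ∧ ∀ z ∈ Metric.closedBall c (c.im / 2), z.im ^ (α / 2) ≤ C := by
  have hy : 0 < c.im := hc
  refine ⟨(2 * c.im) ^ (α / 2), by positivity, fun z hz => ?_⟩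
  have hz' : ‖z - c‖ ≤ c.im / 2 := by simpa [dist_eq_norm] using hz
  have h2 := (abs_le.1 ((Complex.abs_im_le_norm (z - c)).trans hz')).2
  simp only [sub_im] at h2
  have h3 : 0 < z.im := closedBall_subset_halfPlane hc hz
  exact Real.rpow_le_rpow h3.le (by linarith) (by positivity)

section Convergence

variable {Ω : Type*} [MeasurableSpace Ω] {P : Measure Ω} [IsProbabilityMeasure P] {a : ℕ → Ω → ℂ}

/-- The white noise of a fixed function is also the almost sure sum of its series. -/
theorem IsWhiteNoise.ae_tendsto (ha : IsStdComplexGaussianSeq P a) {e : L2Basis}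
    {N : (ℝ → ℂ) → Ω → ℂ} (hN : IsWhiteNoise P a e N) {s : ℝ → ℂ} (hs : MemLp s 2 volume) :
    ∀ᵐ ω ∂P, Tendsto (fun m => noisePartialSum a e s m ω) atTop (𝓝 (N s ω)) := by
  obtain ⟨hNs, hlim⟩ := hN s hs
  have hmeas : ∀ m, AEStronglyMeasurable (fun ω => noisePartialSum a e s m ω) P := fun m =>
    (memLp_sum_smul ha (fun n => coeff e s n) (Finset.range m)).1
  obtain ⟨φ, hφ, hsub⟩ := (tendstoInMeasure_of_tendsto_eLpNorm (by norm_num) hmeas hNs.1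
    hlim).exists_seq_tendsto_ae
  have hc := ae_cauchySeq_sum_smul ha (hasSum_norm_sq_coeff e hs).summable
  filter_upwards [hsub, hc] with ω h1 h2
  obtain ⟨l, hl⟩ := cauchySeq_tendsto_of_complete h2
  have h3 := tendsto_nhds_unique (hl.comp hφ.tendsto_atTop) h1
  rw [← h3]
  exact hl

theorem ae_uniformCauchySeqOn_disc (ha : IsStdComplexGaussianSeq P a) (e : L2Basis) {α : ℝ}
    (hα : 0 < α) {c : ℂ} (hc : c ∈ halfPlane) :
    ∀ᵐ ω ∂P, UniformCauchySeqOn (fun m z => noisePartialSum a e (waveletAtom α z) m ω) atTop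
      (Metric.closedBall c (c.im / 2 / 2)) := by
  have hy : 0 < c.im := hc
  have hs : 1 / 2 < (α + 1) / 2 := by linarith
  obtain ⟨B, hB⟩ := exists_integral_powerKernel_le hs hc
  obtain ⟨C, hC0, hC⟩ := exists_im_rpow_le hα hc
  obtain ⟨v, hv, hvz⟩ := exists_circle_vectors e (half_pos hy) (closedBall_subset_halfPlane hc)
    (fun z hz => memLp_conj_powerKernel hs hz) hB (differentiableOn_conj_coeff e hs)
  have hsum : Summable fun n => ‖v n‖ ^ 2 :=
    summable_of_sum_range_le (fun n => by positivity) hv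
  filter_upwards [ae_cauchySeq_sum_smul ha hsum] with ω hω
  rw [Metric.uniformCauchySeqOn_iff]
  intro ε hε
  obtain ⟨M, hM⟩ := Metric.cauchySeq_iff'.1 hω (ε / C / 2) (by positivity)
  -- a tail of the series is small on the disc because it is small on the circle
  have key : ∀ m ≥ M, ∀ z ∈ Metric.closedBall c (c.im / 2 / 2),
      dist (noisePartialSum a e (waveletAtom α z) m ω)
        (noisePartialSum a e (waveletAtom α z) M ω) < ε / 2 := by
    intro m hm z hz
    have hz' : z ∈ Metric.closedBall c (c.im / 2) :=
      Metric.closedBall_subset_closedBall (by linarith) hz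
    have hzH := closedBall_subset_halfPlane hc hz'
    have hz0 : 0 < z.im := hzH
    have h1 := hM m hm
    rw [dist_eq_norm, ← Finset.sum_Ico_eq_sub _ hm] at h1
    rw [dist_eq_norm, noisePartialSum, noisePartialSum, ← Finset.sum_Ico_eq_sub _ hm]
    simp_rw [coeff_waveletAtom e (show -1 < α by linarith) hzH, mul_left_comm (a _ ω)]
    rw [← Finset.mul_sum, norm_mul, Complex.norm_real, Real.norm_of_nonneg (by positivity)]
    calc _ ≤ C * ‖∑ n ∈ Finset.Ico M m, a n ω • v n‖ :=
          mul_le_mul (hC z hz') (hvz z hz (fun n => a n ω) _) (norm_nonneg _) hC0.le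
      _ < C * (ε / C / 2) := by gcongr
      _ = ε / 2 := by field_simp
  refine ⟨M, fun m hm k hk z hz => ?_⟩
  have h1 := key m hm z hz
  have h2 := key k hk z hz
  have h3 := dist_triangle_right (noisePartialSum a e (waveletAtom α z) m ω)
    (noisePartialSum a e (waveletAtom α z) k ω) (noisePartialSum a e (waveletAtom α z) M ω)
  linarith

/-- A property of discs that holds almost surely for each disc of a family indexed by the half-plane
holds almost surely for a subfamily that covers the half-plane. -/
theorem ae_exists_cover {Ω : Type*} [MeasurableSpace Ω] {P : Measure Ω} {p : ℂ → Ω → Prop} (hp : ∀ c ∈ halfPlane, ∀ᵐ ω ∂P, p c ω) :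
    ∀ᵐ ω ∂P, ∀ z ∈ halfPlane, ∃ c ∈ halfPlane, z ∈ Metric.ball c (c.im / 2 / 2) ∧ p c ω := by
  obtain ⟨t, htH, htc, ht⟩ := TopologicalSpace.countable_cover_nhdsWithin (s := halfPlane)
    (f := fun c => Metric.ball c (c.im / 2 / 2)) fun c hc => by
      have hy : 0 < c.im := hc
      exact mem_nhdsWithin_of_mem_nhds (Metric.ball_mem_nhds c (by positivity))
  have h := (ae_ball_iff htc).2 fun c hc => hp c (htH hc)
  filter_upwards [h] with ω hω z hz
  obtain ⟨c, hc, hzc⟩ := Set.mem_iUnion₂.1 (ht hz)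
  exact ⟨c, htH hc, hzc, hω c hc⟩

theorem ball_mem_nhdsWithin {z c : ℂ} {r : ℝ} (h : z ∈ Metric.ball c r) :
    Metric.closedBall c r ∈ 𝓝[halfPlane] z :=
  mem_nhdsWithin_of_mem_nhds
    (mem_of_superset (Metric.isOpen_ball.mem_nhds h) Metric.ball_subset_closedBall)

/-- Almost sure locally uniform convergence of the series that defines the wavelet transform. -/
theorem ae_tendstoLocallyUniformlyOn_noiseWT (ha : IsStdComplexGaussianSeq P a) (e : L2Basis)
    {α : ℝ} (hα : 0 < α) :
    ∀ᵐ ω ∂P, TendstoLocallyUniformlyOn (fun m z => noisePartialSum a e (waveletAtom α z) m ω)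
        (fun z => noiseWT α a e z ω) atTop halfPlane := by
  filter_upwards [ae_exists_cover fun c hc => ae_uniformCauchySeqOn_disc ha e hα hc] with ω hω
  refine tendstoLocallyUniformlyOn_of_forall_exists_nhds fun z hz => ?_
  obtain ⟨c, _, hzc, hu⟩ := hω z hz
  refine ⟨_, ball_mem_nhdsWithin hzc, hu.tendstoUniformlyOn_of_tendsto fun w hw => ?_⟩
  exact (hu.cauchySeq hw).tendsto_limUnder

theorem noiseWT_ae_eq (ha : IsStdComplexGaussianSeq P a) {e : L2Basis}
    {N : (ℝ → ℂ) → Ω → ℂ} (hN : IsWhiteNoise P a e N) {α : ℝ} (hα : 0 < α) {z : ℂ}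
    (hz : z ∈ halfPlane) : noiseWT α a e z =ᵐ[P] N (waveletAtom α z) := by
  filter_upwards [hN.ae_tendsto ha (memLp_waveletAtom hα hz)] with ω hω
  exact hω.limUnder_eq

/-- On a realization for which all series converge, the error of the discretized transform is the
sum of the series of the sampling error. -/
theorem tendsto_discreteNoiseWT_sub {Ω : Type*} {a : ℕ → Ω → ℂ} {e : L2Basis}
    {N : (ℝ → ℂ) → Ω → ℂ} {α : ℝ}
    (hα : 0 < α) {z : ℂ} (hz : z ∈ halfPlane) {ω : Ω} {L : ℕ}
    (h1 : Tendsto (fun m => noisePartialSum a e (waveletAtom α z) m ω) atTop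
      (𝓝 (noiseWT α a e z ω)))
    (h2 : ∀ ℓ : ℤ, Tendsto (fun m => noisePartialSum a e (sampleCell (samplingInterval α L) ℓ) m ω)
      atTop (𝓝 (N (sampleCell (samplingInterval α L) ℓ) ω))) :
    Tendsto (fun m => ((z.im ^ (α / 2) : ℝ) : ℂ) *
        ∑ n ∈ Finset.range m, a n ω * coeff e (samplingError α L z) n) atTop
      (𝓝 (discreteNoiseWT α N L (samplingInterval α L) z ω - noiseWT α a e z ω)) := by
  have h3 := (tendsto_finsetSum (Finset.Icc (-(L : ℤ) + 1) (L : ℤ)) fun ℓ _ =>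
    (h2 ℓ).mul_const (waveletAtom α z ((ℓ : ℝ) * samplingInterval α L))).sub h1
  refine h3.congr fun m => ?_
  simp_rw [coeff_samplingError e hα L hz, noisePartialSum, coeff_waveletAtom e
    (show -1 < α by linarith) hz, waveletAtom_eq (show -1 < α by linarith) hz, mul_sub,
    Finset.sum_sub_distrib, mul_sub, Finset.mul_sum, Finset.sum_mul]
  congr 1
  · rw [Finset.sum_comm]
    refine Finset.sum_congr rfl fun n _ => Finset.sum_congr rfl fun ℓ _ => ?_
    ring
  · refine Finset.sum_congr rfl fun n _ => ?_
    ring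

theorem ae_tendstoUniformlyOn_disc (ha : IsStdComplexGaussianSeq P a) {e : L2Basis}
    {N : (ℝ → ℂ) → Ω → ℂ} (hN : IsWhiteNoise P a e N) {α : ℝ} (hα : 1 < α) {c : ℂ}
    (hc : c ∈ halfPlane) :
    ∀ᵐ ω ∂P, TendstoUniformlyOn
      (fun (L : ℕ) z => discreteNoiseWT α N L (samplingInterval α L) z ω)
      (fun z => noiseWT α a e z ω) atTop (Metric.closedBall c (c.im / 2 / 2)) := by
  have hy : 0 < c.im := hc
  have hα0 : 0 < α := by linarith
  obtain ⟨B, hB⟩ := exists_integral_samplingError_le hα0 hc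
  obtain ⟨C, hC0, hC⟩ := exists_im_rpow_le hα0 hc
  choose v hv hvz using fun L : ℕ => exists_circle_vectors e (half_pos hy)
    (closedBall_subset_halfPlane hc) (fun z hz => memLp_samplingError hα0 (L + 1) hz)
    (hB (L + 1) (by omega)) (differentiableOn_conj_coeff_samplingError e hα0 (L + 1))
  have hsum := summable_error hα (2 * Real.pi * B)
  have hcells : ∀ᵐ ω ∂P, ∀ L : ℕ, ∀ ℓ : ℤ, Tendsto (fun m =>
      noisePartialSum a e (sampleCell (samplingInterval α L) ℓ) m ω) atTop
      (𝓝 (N (sampleCell (samplingInterval α L) ℓ) ω)) :=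
    ae_all_iff.2 fun L => ae_all_iff.2 fun ℓ => hN.ae_tendsto ha (memLp_sampleCell _ _)
  have hlim := ae_tendsto_liminf_norm_pow_four ha (v := v) hsum fun L m =>
    (hv L m).trans_eq (mul_assoc _ _ _).symm
  filter_upwards [hcells, hlim, ae_tendstoLocallyUniformlyOn_noiseWT ha e hα0] with ω h1 h2 h3
  rw [Metric.tendstoUniformlyOn_iff]
  intro ε hε
  set η : ℝ := ε / C / 2 with hη
  have hη0 : 0 < η := by positivity
  have h4 := (tendsto_order.1 h2).2 (ENNReal.ofReal (η ^ 4)) (by simpa using by positivity)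
  rw [← map_add_atTop_eq_nat 1, eventually_map]
  filter_upwards [h4] with L hL z hz
  have hz' : z ∈ Metric.closedBall c (c.im / 2) :=
    Metric.closedBall_subset_closedBall (by linarith) hz
  have hzH := closedBall_subset_halfPlane hc hz'
  have hz0 : 0 < z.im := hzH
  have h5 := tendsto_discreteNoiseWT_sub hα0 hzH (h3.tendsto_at hzH) (h1 (L + 1))
  have h6 := frequently_lt_of_liminf_lt (by isBoundedDefault) hL
  have h7 : ∃ᶠ m in atTop, ((z.im ^ (α / 2) : ℝ) : ℂ) * ∑ n ∈ Finset.range m,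
      a n ω * coeff e (samplingError α (L + 1) z) n ∈ Metric.closedBall (0 : ℂ) (ε / 2) := by
    refine h6.mono fun m hm => ?_
    have h8 : ‖∑ n ∈ Finset.range m, a n ω • v L n‖ ≤ η := by
      have := (ENNReal.ofReal_lt_ofReal_iff (by positivity)).1 hm
      exact (lt_of_pow_lt_pow_left₀ 4 hη0.le this).le
    rw [mem_closedBall_zero_iff, norm_mul, Complex.norm_real, Real.norm_of_nonneg (by positivity)]
    calc _ ≤ C * η := mul_le_mul (hC z hz') ((hvz L z hz (fun n => a n ω) _).trans h8)
          (norm_nonneg _) hC0.le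
      _ = ε / 2 := by rw [hη]; field_simp
  have h9 := Metric.isClosed_closedBall.mem_of_frequently_of_tendsto h7 h5
  rw [mem_closedBall_zero_iff] at h9
  rw [dist_comm, dist_eq_norm]
  linarith

/-- Almost surely, the discretized transform converges uniformly on every compact set. -/
theorem ae_tendstoUniformlyOn_discreteNoiseWT (ha : IsStdComplexGaussianSeq P a) {e : L2Basis}
    {N : (ℝ → ℂ) → Ω → ℂ} (hN : IsWhiteNoise P a e N) {α : ℝ} (hα : 1 < α) :
    ∀ᵐ ω ∂P, ∀ D : Set ℂ, IsCompact D → D ⊆ halfPlane →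
      TendstoUniformlyOn (fun (L : ℕ) z => discreteNoiseWT α N L (samplingInterval α L) z ω)
        (fun z => noiseWT α a e z ω) atTop D := by
  filter_upwards [ae_exists_cover fun c hc => ae_tendstoUniformlyOn_disc ha hN hα hc]
    with ω hω D hD hDH
  rw [← tendstoLocallyUniformlyOn_iff_tendstoUniformlyOn_of_compact hD]
  refine TendstoLocallyUniformlyOn.mono ?_ hDH
  refine tendstoLocallyUniformlyOn_of_forall_exists_nhds fun z hz => ?_
  obtain ⟨c, _, hzc, hu⟩ := hω z hz
  exact ⟨_, ball_mem_nhdsWithin hzc, hu⟩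

end Convergence

/-! ### The law of a Gaussian series -/

section Law

variable {Ω : Type*} [MeasurableSpace Ω] {P : Measure Ω} [IsProbabilityMeasure P] {a : ℕ → Ω → ℂ}

theorem charFun_map_mul_const {Ω : Type*} [MeasurableSpace Ω] {P : Measure Ω} {a : ℕ → Ω → ℂ}
    (ha : IsStdComplexGaussianSeq P a) (n : ℕ) (b t : ℂ) :
    charFun (P.map fun ω => a n ω * b) t = cexp (-((‖b‖ ^ 2 / 4 * ‖t‖ ^ 2 : ℝ) : ℂ)) := by
  have hm := (ha.hasLaw n).aemeasurable
  have h1 := charFun_complexGaussian 1 (conj b * t)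
  rw [← (ha.hasLaw n).map_eq, charFun_apply, integral_map hm
    (Continuous.aestronglyMeasurable (by fun_prop))] at h1
  rw [charFun_apply, integral_map (hm.mul_const b)
    (Continuous.aestronglyMeasurable (by fun_prop))]
  convert! h1 using 4 with ω
  · simp [Complex.inner]
    ring
  · rw [norm_mul, Complex.norm_conj]
    push_cast
    ring

theorem charFun_map_sum (ha : IsStdComplexGaussianSeq P a) (hm : ∀ n, Measurable (a n))
    (b : ℕ → ℂ) (m : ℕ) (t : ℂ) :
    charFun (P.map fun ω => ∑ n ∈ Finset.range m, a n ω * b n) t =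
      cexp (-(((∑ n ∈ Finset.range m, ‖b n‖ ^ 2) / 4 * ‖t‖ ^ 2 : ℝ) : ℂ)) := by
  induction m with
  | zero => simp [Measure.map_const, charFun_dirac]
  | succ m ih =>
    have hpast := stronglyMeasurable_sum_smul hm b (s := Finset.range m) (m := m)
      fun n hn => Finset.mem_range.1 hn
    have hind : IndepFun (fun ω => ∑ n ∈ Finset.range m, a n ω * b n) (fun ω => a m ω * b m) P :=
      ((indepFun_of_pastFiltration ha hm hpast.measurable).comp (φ := fun z : ℂ => z * b m)
        (ψ := id) (by fun_prop) measurable_id).symm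
    have hS : Measurable fun ω => ∑ n ∈ Finset.range m, a n ω * b n :=
      Finset.measurable_fun_sum _ fun n _ => (hm n).mul_const _
    simp_rw [Finset.sum_range_succ]
    rw [hind.charFun_map_fun_add_eq_mul hS.aemeasurable ((hm m).mul_const _).aemeasurable,
      Pi.mul_apply, ih, charFun_map_mul_const ha, ← Complex.exp_add]
    congr 1
    push_cast
    ring

/-- The almost sure sum of a Gaussian series is Gaussian. -/
theorem hasLaw_of_tendsto_sum (ha : IsStdComplexGaussianSeq P a) {b : ℕ → ℂ} {v : NNReal}
    (hv : HasSum (fun n => ‖b n‖ ^ 2) (v : ℝ)) {Z : Ω → ℂ}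
    (hZ : ∀ᵐ ω ∂P, Tendsto (fun m => ∑ n ∈ Finset.range m, a n ω * b n) atTop (𝓝 (Z ω))) :
    HasLaw Z (complexGaussian v) P := by
  obtain ⟨a', ha', hm, haa'⟩ := ha.exists_measurable
  have hZ' : ∀ᵐ ω ∂P, Tendsto (fun m => ∑ n ∈ Finset.range m, a' n ω * b n) atTop (𝓝 (Z ω)) := by
    filter_upwards [hZ, haa'] with ω h1 h2
    simpa only [h2] using h1
  have hS : ∀ m, Measurable fun ω => ∑ n ∈ Finset.range m, a' n ω * b n := fun m =>
    Finset.measurable_fun_sum _ fun n _ => (hm n).mul_const _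
  have hZm : AEMeasurable Z P :=
    aemeasurable_of_tendsto_metrizable_ae atTop (fun m => (hS m).aemeasurable) hZ'
  refine hasLaw_complexGaussian_of_charFun hZm fun t => ?_
  have h1 : Tendsto (fun m => charFun (P.map fun ω => ∑ n ∈ Finset.range m, a' n ω * b n) t)
      atTop (𝓝 (charFun (P.map Z) t)) := by
    have hcont : Continuous fun z : ℂ => cexp (((inner ℝ z t : ℝ) : ℂ) * I) := by fun_prop
    simp_rw [charFun_apply]
    rw [integral_map hZm hcont.aestronglyMeasurable]
    refine Tendsto.congr
      (fun m => (integral_map (hS m).aemeasurable hcont.aestronglyMeasurable).symm) ?_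
    refine tendsto_integral_of_dominated_convergence (fun _ => (1 : ℝ))
      (fun m => (hcont.measurable.comp (hS m)).aestronglyMeasurable) (integrable_const _)
      (fun m => ae_of_all _ fun ω => (Complex.norm_exp_ofReal_mul_I _).le) ?_
    filter_upwards [hZ'] with ω hω
    exact (hcont.tendsto _).comp hω
  refine tendsto_nhds_unique h1 ?_
  simp_rw [charFun_map_sum ha' hm]
  have hc : Continuous fun x : ℝ => cexp (-((x / 4 * ‖t‖ ^ 2 : ℝ) : ℂ)) := by fun_prop
  exact (hc.tendsto (v : ℝ)).comp hv.tendsto_sum_nat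

end Law

/-! ### The covariance of the kernels -/

open FourierTransform

/-- The density `ξ ^ (s - 1) exp (i ξ z)` on `ξ > 0`, whose Fourier integral is
`powerKernel s z`. The exponent `s - 1` is positive in all uses, so that it is continuous at `0`. -/
def powerDensity (s : ℝ) (z : ℂ) (ξ : ℝ) : ℂ :=
  (((max ξ 0) ^ (s - 1) : ℝ) : ℂ) * cexp (I * z * ξ)

theorem continuous_powerDensity {s : ℝ} (hs : 1 < s) (z : ℂ) : Continuous (powerDensity s z) := by
  have h1 : Continuous fun ξ : ℝ => (max ξ 0) ^ (s - 1) :=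
    (continuous_id.max continuous_const).rpow_const fun _ => Or.inr (by linarith)
  exact (Complex.continuous_ofReal.comp h1).mul (by fun_prop)

theorem powerDensity_mul_cexp {s : ℝ} (hs : 1 < s) (z w : ℂ) (ξ : ℝ) :
    powerDensity s z ξ * cexp (w * ξ) = (Set.Ioi (0 : ℝ)).indicator
      (fun ξ : ℝ => ((ξ ^ (s - 1) : ℝ) : ℂ) * cexp (-((-I * z - w) * ξ))) ξ := by
  by_cases hξ : 0 < ξ
  · rw [Set.indicator_of_mem (by exact hξ), powerDensity, max_eq_left hξ.le, mul_assoc,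
      ← Complex.exp_add]
    congr 2
    ring
  · rw [Set.indicator_of_notMem (by exact hξ), powerDensity, max_eq_right (not_lt.1 hξ),
      Real.zero_rpow (by linarith)]
    simp

theorem integrable_powerDensity {s : ℝ} (hs : 1 < s) {z : ℂ} (hz : z ∈ halfPlane) :
    Integrable (powerDensity s z) := by
  have h1 : ∀ ξ, powerDensity s z ξ = (Set.Ioi (0 : ℝ)).indicator
      (fun ξ : ℝ => ((ξ ^ (s - 1) : ℝ) : ℂ) * cexp (-((-I * z - 0) * ξ))) ξ := fun ξ => by
    rw [← powerDensity_mul_cexp hs]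
    simp
  rw [funext h1, integrable_indicator_iff measurableSet_Ioi]
  exact integrableOn_rpow_mul_cexp (by linarith) (by simpa using show 0 < z.im from hz)

theorem fourier_powerDensity {s : ℝ} (hs : 1 < s) {z : ℂ} (hz : z ∈ halfPlane) (u : ℝ) :
    𝓕 (powerDensity s z) u = powerKernel s z (u * (2 * Real.pi)) := by
  rw [Real.fourier_real_eq_integral_exp_smul]
  have h1 : ∀ ξ : ℝ, cexp (((-2 * Real.pi * ξ * u : ℝ) : ℂ) * I) • powerDensity s z ξ =
      powerDensity s z ξ * cexp ((-(2 * Real.pi * u * I)) * ξ) := fun ξ => by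
    rw [smul_eq_mul, mul_comm]
    congr 2
    push_cast
    ring
  simp_rw [h1, powerDensity_mul_cexp hs]
  rw [integral_indicator measurableSet_Ioi, integral_rpow_mul_cexp (by linarith)
    (by simpa using show 0 < z.im from hz), powerKernel]
  congr 2
  push_cast
  ring

theorem integrable_powerKernel {s : ℝ} (hs : 1 < s) {z : ℂ} (hz : z ∈ halfPlane) :
    Integrable (powerKernel s z) := by
  obtain ⟨δ, hδ, h⟩ := exists_le_norm_sub_ofReal hz
  have hy : 0 < z.im := hz
  exact ((integrable_decay hs).const_mul (Real.Gamma s * δ ^ (-s))).mono'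
    (continuous_powerKernel (by linarith) hz).aestronglyMeasurable
    (ae_of_all _ fun t => norm_powerKernel_le (by linarith) hδ
      (h z (Metric.mem_closedBall_self (by positivity)) t))

theorem fourier_conj_powerKernel {s : ℝ} (hs : 1 < s) {w : ℂ} (hw : w ∈ halfPlane) (ξ : ℝ) :
    𝓕 (fun u => conj (𝓕 (powerDensity s w) u)) ξ = conj (powerDensity s w ξ) := by
  have hint : Integrable (𝓕 (powerDensity s w)) := by
    rw [funext (fourier_powerDensity hs hw)]
    exact (integrable_powerKernel hs hw).comp_mul_right' (by positivity)
  have h := (continuous_powerDensity hs w).fourierInv_fourier_eq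
    (integrable_powerDensity hs hw) hint
  conv_rhs => rw [← h]
  rw [Real.fourierInv_eq_fourier_neg, Real.fourier_real_eq_integral_exp_smul,
    Real.fourier_real_eq_integral_exp_smul, ← integral_conj]
  refine integral_congr_ae (ae_of_all _ fun u => ?_)
  simp only [smul_eq_mul, map_mul, ← Complex.exp_conj, Complex.conj_ofReal, Complex.conj_I]
  congr 2
  push_cast
  ring

/-- Plancherel's identity for the kernels, with the resulting Gamma integral evaluated. -/
theorem integral_powerKernel_mul_conj {s : ℝ} (hs : 1 < s) {z w : ℂ} (hz : z ∈ halfPlane)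
    (hw : w ∈ halfPlane) :
    ∫ t, powerKernel s z t * conj (powerKernel s w t) =
      ((2 * Real.pi * Real.Gamma (2 * s - 1) : ℝ) : ℂ) *
        (-I * (z - conj w)) ^ (-((2 * s - 1 : ℝ) : ℂ)) := by
  have hint : Integrable (fun u => conj (𝓕 (powerDensity s w) u)) := by
    simp_rw [fourier_powerDensity hs hw]
    exact Complex.conjCLE.toContinuousLinearMap.integrable_comp
      ((integrable_powerKernel hs hw).comp_mul_right' (by positivity))
  have hflip : ∫ u, 𝓕 (powerDensity s z) u • conj (𝓕 (powerDensity s w) u) =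
      ∫ ξ, powerDensity s z ξ • 𝓕 (fun u => conj (𝓕 (powerDensity s w) u)) ξ := by
    have h := VectorFourier.integral_fourierIntegral_smul_eq_flip (L := innerₗ ℝ)
      Real.continuous_fourierChar continuous_inner (integrable_powerDensity hs hz) hint
      (μ := volume) (ν := volume)
    rw [flip_innerₗ] at h
    exact h
  have hscale := Measure.integral_comp_mul_right
    (fun t => powerKernel s z t * conj (powerKernel s w t)) (2 * Real.pi)
  have h1 : ∫ t, powerKernel s z t * conj (powerKernel s w t) =
      ((2 * Real.pi : ℝ) : ℂ) * ∫ u, 𝓕 (powerDensity s z) u • conj (𝓕 (powerDensity s w) u) := by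
    simp_rw [fourier_powerDensity hs hz, fourier_powerDensity hs hw, smul_eq_mul]
    rw [hscale, abs_of_pos (by positivity), Complex.real_smul, ← mul_assoc, ← Complex.ofReal_mul,
      mul_inv_cancel₀ (by positivity), Complex.ofReal_one, one_mul]
  rw [h1, hflip]
  simp_rw [fourier_conj_powerKernel hs hw, smul_eq_mul]
  have h2 : ∀ ξ, powerDensity s z ξ * conj (powerDensity s w ξ) = (Set.Ioi (0 : ℝ)).indicator
      (fun ξ : ℝ => ((ξ ^ (2 * s - 1 - 1) : ℝ) : ℂ) * cexp (-((-I * (z - conj w)) * ξ))) ξ := by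
    intro ξ
    by_cases hξ : 0 < ξ
    · rw [Set.indicator_of_mem (by exact hξ), powerDensity, powerDensity, max_eq_left hξ.le]
      have h3 : ξ ^ (2 * s - 1 - 1) = ξ ^ (s - 1) * ξ ^ (s - 1) := by
        rw [← Real.rpow_add hξ]
        congr 1
        ring
      have h4 : -((-I * (z - conj w)) * ξ) = I * z * ξ + conj (I * w * ξ) := by
        simp only [map_mul, Complex.conj_I, Complex.conj_ofReal]
        ring
      rw [h3, h4, Complex.exp_add, map_mul, Complex.conj_ofReal, ← Complex.exp_conj]
      push_cast
      ring
    · rw [Set.indicator_of_notMem (by exact hξ), powerDensity, max_eq_right (not_lt.1 hξ),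
        Real.zero_rpow (by linarith)]
      simp
  have hz' : 0 < z.im := hz
  have hw' : 0 < w.im := hw
  simp_rw [h2]
  rw [integral_indicator measurableSet_Ioi, integral_rpow_mul_cexp (by linarith)
    (by simp; linarith)]
  push_cast
  ring

theorem bergmanKernel_eq (α : ℝ) {z w : ℂ} (hz : z ∈ halfPlane) (hw : w ∈ halfPlane) :
    bergmanKernel α z w = ((2 ^ (α - 2) * (α - 1) : ℝ) : ℂ) *
      (-I * (z - conj w)) ^ (-(α : ℂ)) := by
  have hz' : 0 < z.im := hz
  have hw' : 0 < w.im := hw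
  have him : 0 < (z - conj w).im := by simp; linarith
  have hne : z - conj w ≠ 0 := fun h => by simp [h] at him
  have hI : -I ≠ 0 := neg_ne_zero.2 I_ne_zero
  have hlog : Complex.log (-I * (z - conj w)) = Complex.log (-I) + Complex.log (z - conj w) := by
    refine Complex.log_mul hI hne ?_
    rw [Complex.arg_neg_I]
    have h1 := Complex.arg_nonneg_iff.2 him.le
    have h2 := Complex.arg_le_pi (z - conj w)
    have h3 := Real.pi_pos
    constructor <;> linarith
  rw [bergmanKernel, div_eq_mul_inv, Complex.cpow_neg]
  congr 2
  rw [cpow_def_of_ne_zero hI, cpow_def_of_ne_zero hne,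
    cpow_def_of_ne_zero (mul_ne_zero hI hne), hlog, add_mul, Complex.exp_add]

/-! ### The hyperbolic Gaussian analytic function -/

/-- The constant `c` with `c ^ 2 * 2 π Γ(α) = 2 ^ (α - 2) (α - 1)`, which matches the covariance of
the transform of white noise with the reproducing kernel. -/
def gafConstant (α : ℝ) : ℝ :=
  √(2 ^ (α - 2) * (α - 1) / (2 * Real.pi * Real.Gamma α))

theorem gafConstant_arg_pos {α : ℝ} (hα : 1 < α) :
    0 < 2 ^ (α - 2) * (α - 1) / (2 * Real.pi * Real.Gamma α) := by
  have h1 := Real.Gamma_pos_of_pos (show 0 < α by linarith)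
  have h2 : 0 < α - 1 := by linarith
  positivity

theorem gafConstant_pos {α : ℝ} (hα : 1 < α) : 0 < gafConstant α :=
  Real.sqrt_pos.2 (gafConstant_arg_pos hα)

theorem gafConstant_sq_mul {α : ℝ} (hα : 1 < α) :
    gafConstant α ^ 2 * (2 * Real.pi * Real.Gamma α) = 2 ^ (α - 2) * (α - 1) := by
  have h1 := Real.Gamma_pos_of_pos (show 0 < α by linarith)
  rw [gafConstant, Real.sq_sqrt (gafConstant_arg_pos hα).le]
  field_simp

/-- The random analytic function on the upper half-plane obtained from the wavelet transform of
white noise by removing the factor `y ^ (α / 2)` and conjugating. -/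
def noiseGAF {Ω : Type*} (α : ℝ) (a : ℕ → Ω → ℂ) (e : L2Basis) (z : ℂ) (ω : Ω) : ℂ :=
  conj (((gafConstant α / z.im ^ (α / 2) : ℝ) : ℂ) * noiseWT α a e z ω)

theorem noiseWT_eq_conj_noiseGAF {Ω : Type*} {α : ℝ} (hα : 1 < α) (a : ℕ → Ω → ℂ) (e : L2Basis)
    {z : ℂ} (hz : z ∈ halfPlane) (ω : Ω) :
    noiseWT α a e z ω =
      ((z.im ^ (α / 2) / gafConstant α : ℝ) : ℂ) * conj (noiseGAF α a e z ω) := by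
  have hz' : 0 < z.im := hz
  have hc := gafConstant_pos hα
  have hy : 0 < z.im ^ (α / 2) := by positivity
  rw [noiseGAF, Complex.conj_conj, ← mul_assoc, ← Complex.ofReal_mul]
  have : z.im ^ (α / 2) / gafConstant α * (gafConstant α / z.im ^ (α / 2)) = 1 := by
    field_simp
  rw [this, Complex.ofReal_one, one_mul]

theorem factor_mul_noisePartialSum {Ω : Type*} {α : ℝ} (hα : 0 < α) (a : ℕ → Ω → ℂ) (e : L2Basis)
    {z : ℂ} (hz : z ∈ halfPlane) (m : ℕ) (ω : Ω) :
    ((gafConstant α / z.im ^ (α / 2) : ℝ) : ℂ) * noisePartialSum a e (waveletAtom α z) m ω =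
      ∑ n ∈ Finset.range m, a n ω *
        (gafConstant α * coeff e (fun t => conj (powerKernel ((α + 1) / 2) z t)) n) := by
  have hz' : 0 < z.im := hz
  have hy : ((z.im ^ (α / 2) : ℝ) : ℂ) ≠ 0 := by
    exact_mod_cast (Real.rpow_pos_of_pos hz' _).ne'
  rw [noisePartialSum, Finset.mul_sum]
  refine Finset.sum_congr rfl fun n _ => ?_
  rw [coeff_waveletAtom e (by linarith) hz, Complex.ofReal_div]
  field_simp

/-- Realizations are analytic wherever the defining series converges locally uniformly. -/
theorem differentiableOn_noiseGAF {Ω : Type*} {α : ℝ} (hα : 1 < α) {a : ℕ → Ω → ℂ} {e : L2Basis}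
    {ω : Ω} (h : TendstoLocallyUniformlyOn
      (fun m z => noisePartialSum a e (waveletAtom α z) m ω)
      (fun z => noiseWT α a e z ω) atTop halfPlane) :
    DifferentiableOn ℂ (fun z => noiseGAF α a e z ω) halfPlane := by
  have hopen : IsOpen halfPlane := isOpen_lt continuous_const Complex.continuous_im
  have hα0 : 0 < α := by linarith
  have hcpos := gafConstant_pos hα
  have hlim : TendstoLocallyUniformlyOn (fun m z => conj (((gafConstant α / z.im ^ (α / 2) : ℝ) : ℂ)
      * noisePartialSum a e (waveletAtom α z) m ω)) (fun z => noiseGAF α a e z ω) atTop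
      halfPlane := by
    rw [Metric.tendstoLocallyUniformlyOn_iff]
    intro ε hε z hz
    have hz' : 0 < z.im := hz
    -- the factor in front of the series is locally bounded
    set C := gafConstant α / z.im ^ (α / 2) + 1 with hC
    have hC0 : 0 < C := by positivity
    have hcont : ContinuousAt (fun w : ℂ => gafConstant α / w.im ^ (α / 2)) z :=
      continuousAt_const.div (Complex.continuous_im.continuousAt.rpow_const (Or.inl hz'.ne'))
        (Real.rpow_pos_of_pos hz' _).ne'
    have hnear : ∀ᶠ w in 𝓝 z, gafConstant α / w.im ^ (α / 2) < C :=
      hcont.eventually (gt_mem_nhds (by linarith))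
    obtain ⟨t, ht, hev⟩ := Metric.tendstoLocallyUniformlyOn_iff.1 h (ε / C) (by positivity) z hz
    refine ⟨t ∩ ({w | gafConstant α / w.im ^ (α / 2) < C} ∩ halfPlane),
      inter_mem ht (inter_mem (mem_nhdsWithin_of_mem_nhds hnear) self_mem_nhdsWithin), ?_⟩
    filter_upwards [hev] with m hm w hw
    have hw' : 0 < w.im := hw.2.2
    have h1 := hm w hw.1
    rw [dist_eq_norm] at h1 ⊢
    rw [noiseGAF, ← map_sub, Complex.norm_conj, ← mul_sub, norm_mul, Complex.norm_real,
      Real.norm_of_nonneg (by positivity)]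
    calc _ ≤ C * ‖noiseWT α a e w ω - noisePartialSum a e (waveletAtom α w) m ω‖ :=
          mul_le_mul_of_nonneg_right (le_of_lt hw.2.1) (norm_nonneg _)
      _ < C * (ε / C) := by gcongr
      _ = ε := by field_simp
  refine hlim.differentiableOn (Eventually.of_forall fun m => ?_) hopen
  have hd : DifferentiableOn ℂ (fun z => ∑ n ∈ Finset.range m, conj (a n ω) * (gafConstant α *
      conj (coeff e (fun t => conj (powerKernel ((α + 1) / 2) z t)) n))) halfPlane :=
    DifferentiableOn.fun_sum fun n _ =>
      ((differentiableOn_conj_coeff e (by linarith) n).const_mul _).const_mul _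
  refine hd.congr fun z hz => ?_
  rw [factor_mul_noisePartialSum hα0 a e hz]
  simp [map_sum]

/-- The variance of a linear combination of values is the corresponding quadratic form of the
reproducing kernel. -/
theorem integral_norm_sq_combination {α : ℝ} (hα : 1 < α) {k : ℕ} {z : Fin k → ℂ} (c : Fin k → ℂ)
    (hz : ∀ j, z j ∈ halfPlane) :
    ((∫ t, ‖∑ j, (gafConstant α * conj (c j)) *
        conj (powerKernel ((α + 1) / 2) (z j) t)‖ ^ 2 : ℝ) : ℂ) =
      ∑ i, ∑ j, c i * conj (c j) * bergmanKernel α (z i) (z j) := by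
  have hs : 1 < (α + 1) / 2 := by linarith
  have hpt : ∀ t, ((‖∑ j, (gafConstant α * conj (c j)) *
      conj (powerKernel ((α + 1) / 2) (z j) t)‖ ^ 2 : ℝ) : ℂ) =
      ∑ i, ∑ j, (gafConstant α ^ 2 * (c i * conj (c j))) *
        (powerKernel ((α + 1) / 2) (z i) t * conj (powerKernel ((α + 1) / 2) (z j) t)) := by
    intro t
    rw [Complex.ofReal_pow, ← Complex.conj_mul', map_sum, Finset.sum_mul_sum]
    refine Finset.sum_congr rfl fun i _ => Finset.sum_congr rfl fun j _ => ?_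
    simp only [map_mul, Complex.conj_conj, Complex.conj_ofReal]
    ring
  have hint : ∀ i j, Integrable fun t => powerKernel ((α + 1) / 2) (z i) t *
      conj (powerKernel ((α + 1) / 2) (z j) t) := fun i j =>
    (memLp_powerKernel (by linarith) (hz i)).integrable_mul
      (memLp_conj_powerKernel (by linarith) (hz j))
  rw [← integral_complex_ofReal]
  simp_rw [hpt]
  rw [integral_finsetSum _ fun i _ => integrable_finsetSum _ fun j _ => (hint i j).const_mul _]
  refine Finset.sum_congr rfl fun i _ => ?_
  rw [integral_finsetSum _ fun j _ => (hint i j).const_mul _]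
  refine Finset.sum_congr rfl fun j _ => ?_
  rw [integral_const_mul, integral_powerKernel_mul_conj hs (hz i) (hz j),
    bergmanKernel_eq α (hz i) (hz j), ← gafConstant_sq_mul hα]
  have h1 : 2 * ((α + 1) / 2) - 1 = α := by ring
  rw [h1]
  push_cast
  ring

theorem isHyperbolicGAF_noiseGAF {Ω : Type*} [MeasurableSpace Ω] {P : Measure Ω}
    [IsProbabilityMeasure P] {a : ℕ → Ω → ℂ} (ha : IsStdComplexGaussianSeq P a) (e : L2Basis)
    {α : ℝ} (hα : 1 < α) : IsHyperbolicGAF P α (noiseGAF α a e) where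
  analytic := by
    filter_upwards [ae_tendstoLocallyUniformlyOn_noiseWT ha e (show 0 < α by linarith)] with ω hω
    exact differentiableOn_noiseGAF hα hω
  gaussian := by
    intro k z c hz
    have hα0 : 0 < α := by linarith
    set S : ℝ → ℂ := fun t => ∑ j, (gafConstant α * conj (c j)) *
        conj (powerKernel ((α + 1) / 2) (z j) t) with hS
    have hmem : ∀ j ∈ Finset.univ, MemLp (fun t => conj (powerKernel ((α + 1) / 2) (z j) t)) 2
        (volume : Measure ℝ) := fun j _ => memLp_conj_powerKernel (by linarith) (hz j)
    have hSL : MemLp S 2 (volume : Measure ℝ) :=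
      memLp_finsetSum _ fun j hj => (hmem j hj).const_mul _
    have hS0 : 0 ≤ ∫ t, ‖S t‖ ^ 2 := integral_nonneg fun t => by positivity
    refine ⟨⟨∫ t, ‖S t‖ ^ 2, hS0⟩, integral_norm_sq_combination hα c hz, ?_⟩
    -- the conjugate of the combination is the sum of the Gaussian series of `S`
    have hlaw : HasLaw (fun ω => ∑ j, conj (c j) * conj (noiseGAF α a e (z j) ω))
        (complexGaussian ⟨∫ t, ‖S t‖ ^ 2, hS0⟩) P := by
      refine hasLaw_of_tendsto_sum ha (b := fun n => coeff e S n)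
        (v := ⟨∫ t, ‖S t‖ ^ 2, hS0⟩) (hasSum_norm_sq_coeff e hSL) ?_
      filter_upwards [ae_tendstoLocallyUniformlyOn_noiseWT ha e hα0] with ω hω
      have h1 := tendsto_finsetSum Finset.univ fun (j : Fin k) _ =>
        ((hω.tendsto_at (hz j)).const_mul
          ((gafConstant α / (z j).im ^ (α / 2) : ℝ) : ℂ)).const_mul (conj (c j))
      simp only [noiseGAF, Complex.conj_conj]
      refine h1.congr fun m => ?_
      simp_rw [factor_mul_noisePartialSum hα0 a e (hz _), hS, coeff_sum e _ _ hmem,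
        Finset.mul_sum]
      rw [Finset.sum_comm]
      refine Finset.sum_congr rfl fun n _ => Finset.sum_congr rfl fun j _ => ?_
      ring
    convert! hasLaw_conj_complexGaussian hlaw using 2 with ω
    simp [map_sum]

end WaveletNoise

end

theorem theorem1 {α : ℝ} (hα : 1 < α) {Ω : Type*} [MeasurableSpace Ω] (P : Measure Ω)
    [IsProbabilityMeasure P] (a : ℕ → Ω → ℂ) (ha : WaveletNoise.IsStdComplexGaussianSeq P a)
    (e : WaveletNoise.L2Basis) (N : (ℝ → ℂ) → Ω → ℂ) (hN : WaveletNoise.IsWhiteNoise P a e N) :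
    -- the random series that defines the wavelet transform of white noise converges almost surely,
    -- locally uniformly, and its sum at `z = x + i y` is `N (T_x D_y ψ_α)`
    (∀ᵐ ω ∂P, TendstoLocallyUniformlyOn
        (fun m z => WaveletNoise.noisePartialSum a e (WaveletNoise.waveletAtom α z) m ω)
        (fun z => WaveletNoise.noiseWT α a e z ω) atTop WaveletNoise.halfPlane) ∧
    (∀ z ∈ WaveletNoise.halfPlane,
        WaveletNoise.noiseWT α a e z =ᵐ[P] N (WaveletNoise.waveletAtom α z)) ∧
    -- almost surely, uniform convergence of the discretized transform on every compact set
    (∀ᵐ ω ∂P, ∀ D : Set ℂ, IsCompact D → D ⊆ WaveletNoise.halfPlane →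
        TendstoUniformlyOn
          (fun (L : ℕ) z =>
            WaveletNoise.discreteNoiseWT α N L (WaveletNoise.samplingInterval α L) z ω)
          (fun z => WaveletNoise.noiseWT α a e z ω) atTop D) ∧
    -- the limit is a multiple of (the conjugate of) a hyperbolic Gaussian analytic function; the
    -- covariance of `f` determines `c`, which therefore depends on `α` only
    (∃ c : ℝ, 0 < c ∧ ∃ f : ℂ → Ω → ℂ, WaveletNoise.IsHyperbolicGAF P α f ∧
        ∀ ω, ∀ z ∈ WaveletNoise.halfPlane, WaveletNoise.noiseWT α a e z ω =
          ((z.im ^ (α / 2) / c : ℝ) : ℂ) * (starRingEnd ℂ) (f z ω)) :=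
  have hα0 : 0 < α := by linarith
  ⟨WaveletNoise.ae_tendstoLocallyUniformlyOn_noiseWT ha e hα0,
    fun _ hz => WaveletNoise.noiseWT_ae_eq ha hN hα0 hz,
    WaveletNoise.ae_tendstoUniformlyOn_discreteNoiseWT ha hN hα,
    WaveletNoise.gafConstant α, WaveletNoise.gafConstant_pos hα, WaveletNoise.noiseGAF α a e,
    WaveletNoise.isHyperbolicGAF_noiseGAF ha e hα,
    fun ω _ hz => WaveletNoise.noiseWT_eq_conj_noiseGAF hα a e hz ω⟩
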